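/- Theorem. For an alphabet $\Sigma$, a $\Sigma$-DAG is a finite directed acyclic graph $G=(V,E,s,t)$ with labeled edges $E\subseteq V\times\Sigma\times V$ and with a unique source $s$ and a unique sink $t$, such that every vertex lies on a path from $s$ to $t$. Its language $L(G)\subseteq\Sigma^*$ is the set of all strings spelled out by the edge labels along paths from $s$ to $t$. In the problem Max-Min Diverse String Set, the input consists of integers $K\ge 1$, $r\ge 0$, $\Delta\ge 0$, and a $\Sigma$-DAG $G$ over a finite alphabet $\Sigma$ with $L(G)\subseteq\Sigma^r$. The question is whether there is a set $\mathcal X\subseteq L(G)$ with $|\mathcal X|=K$ in which any two distinct strings have Hamming distance at least $\Delta$, that is, $\min_{X\ne Y\in\mathcal X}d_H(X,Y)\ge\Delta$ (where the minimum over no pair is $\infty$). Then this problem is fixed-parameter tractable when parameterized by $(r,K)$: there are a (deterministic) algorithm on the word RAM, a computable function $f:\mathbb N^2\to\mathbb N$ and a constant $c>0$ such that the algorithm correctly decides every instance $x$ in at most $f(r,K)\cdot|x|^c$ steps. Here vertices and symbols are numbered and each takes one machine word; $|x|=3\cdot|E|+8$ is the number of words of the input ($K$, $r$, $\Delta$,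 $|\Sigma|$, $|V|$, $|E|$, $s$, $t$, and three words for each edge), and the word length may be any $w$ such that the input words and the number $f(r,K)\cdot|x|^c$ are less than $2^w$. -/

import Mathlib

/-! ### Labeled DAGs and the strings they represent -/

/-- `IsPath E u P v`: the list `P` of labeled edges (tail, label, head), all taken from `E`,
is a directed path from `u` to `v`. -/
def IsPath {V A : Type} (E : Set (V × A × V)) : V → List (V × A × V) → V → Prop
  | u, [], v => u = v
  | u, e :: P, v => e ∈ E ∧ e.1 = u ∧ IsPath E e.2.2 P v

/-- The string spelled out by a path. -/
def pathString {V A : Type} (P : List (V × A × V)) : List A :=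
  P.map fun e => e.2.1

/-- A `Σ`-DAG over the alphabet `A`: an edge-labeled directed acyclic graph with a unique source
`s` and a unique sink `t` such that every vertex lies on a path from `s` to `t`. -/
structure SigmaDAG (V A : Type) where
  E : Set (V × A × V)
  s : V
  t : V
  acyclic : ∀ v P, IsPath E v P v → P = []
  source_unique : ∀ v, (∀ e ∈ E, e.2.2 ≠ v) ↔ v = s
  sink_unique : ∀ v, (∀ e ∈ E, e.1 ≠ v) ↔ v = t
  on_path : ∀ v, (∃ P, IsPath E s P v) ∧ (∃ P, IsPath E v P t)

/-- The language `L(G)`: all strings spelled out by paths from the source to the sink. -/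
def SigmaDAG.lang {V A : Type} (G : SigmaDAG V A) : Set (List A) :=
  {x | ∃ P, IsPath G.E G.s P G.t ∧ pathString P = x}

/-- The Min-diversity of a finite set of `r`-strings: the minimum Hamming distance between two
distinct members; the minimum over no pair at all is `⊤`. -/
noncomputable def minDiversity {A : Type} [DecidableEq A] {r : ℕ}
    (X : Finset (Fin r → A)) : ℕ∞ :=
  ⨅ x ∈ X, ⨅ y ∈ X, ⨅ _ : x ≠ y, (hammingDist x y : ℕ∞)

/-! ### The word RAM -/

/-- The arithmetic instructions. -/
inductive ArithOp
  | add | sub | mul | div | mod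

/-- Their values on natural numbers (subtraction is truncated at `0`). -/
def ArithOp.eval : ArithOp → ℕ → ℕ → ℕ
  | .add, a, b => a + b
  | .sub, a, b => a - b
  | .mul, a, b => a * b
  | .div, a, b => a / b
  | .mod, a, b => a % b

/-- Comparisons of the contents of two registers. -/
inductive RegTest
  | eq (a b : ℕ)
  | ne (a b : ℕ)
  | lt (a b : ℕ)
  | le (a b : ℕ)

/-- The contents of the registers and of the memory cells. -/
structure RamState where
  reg : ℕ → ℕ
  mem : ℕ → ℕ

/-- Whether a comparison holds in a state. -/
def RegTest.holds (σ : RamState) : RegTest → Prop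
  | .eq a b => σ.reg a = σ.reg b
  | .ne a b => σ.reg a ≠ σ.reg b
  | .lt a b => σ.reg a < σ.reg b
  | .le a b => σ.reg a ≤ σ.reg b

def RamState.setReg (σ : RamState) (d x : ℕ) : RamState :=
  { σ with reg := Function.update σ.reg d x }

def RamState.setMem (σ : RamState) (a x : ℕ) : RamState :=
  { σ with mem := Function.update σ.mem a x }

/-- Word RAM programs, with structured control flow. The numbers `d`, `a`, `b` name registers;
a fixed program mentions only finitely many of them, and all further storage is in the memory,
which is reached by indirect addressing (`load`, `store`). -/
inductive RamProg
  /-- no effect -/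
  | skip
  /-- register `d` := the constant `k` -/
  | const (d k : ℕ)
  /-- register `d` := register `a` op register `b` -/
  | arith (o : ArithOp) (d a b : ℕ)
  /-- register `d` := the memory cell whose address is in register `a` -/
  | load (d a : ℕ)
  /-- the memory cell whose address is in register `a` := register `b` -/
  | store (a b : ℕ)
  | seq (p q : RamProg)
  | ite (c : RegTest) (p q : RamProg)
  /-- while the test `c` holds, repeat `p` -/
  | loop (c : RegTest) (p : RamProg)

/-- `Exec w p σ T τ`: on a machine with words of `w` bits, the program `p` started in state `σ`
halts in state `τ` after `T` steps. Every instruction and every test costs one step. An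
instruction whose result does not fit into a word has no successful execution. -/
inductive Exec (w : ℕ) : RamProg → RamState → ℕ → RamState → Prop
  | skip (σ) : Exec w .skip σ 1 σ
  | const (d k σ) (h : k < 2 ^ w) : Exec w (.const d k) σ 1 (σ.setReg d k)
  | arith (o d a b σ) (h : ArithOp.eval o (σ.reg a) (σ.reg b) < 2 ^ w) :
      Exec w (.arith o d a b) σ 1 (σ.setReg d (ArithOp.eval o (σ.reg a) (σ.reg b)))
  | load (d a σ) : Exec w (.load d a) σ 1 (σ.setReg d (σ.mem (σ.reg a)))
  | store (a b σ) : Exec w (.store a b) σ 1 (σ.setMem (σ.reg a) (σ.reg b))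
  | seq {p q σ₁ σ₂ σ₃ T₁ T₂} (hp : Exec w p σ₁ T₁ σ₂) (hq : Exec w q σ₂ T₂ σ₃) :
      Exec w (.seq p q) σ₁ (T₁ + T₂) σ₃
  | ite_true {c p q σ₁ σ₂ T} (hc : c.holds σ₁) (hp : Exec w p σ₁ T σ₂) :
      Exec w (.ite c p q) σ₁ (T + 1) σ₂
  | ite_false {c p q σ₁ σ₂ T} (hc : ¬ c.holds σ₁) (hq : Exec w q σ₁ T σ₂) :
      Exec w (.ite c p q) σ₁ (T + 1) σ₂
  | loop_true {c p σ₁ σ₂ σ₃ T₁ T₂} (hc : c.holds σ₁) (hp : Exec w p σ₁ T₁ σ₂)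
      (hl : Exec w (.loop c p) σ₂ T₂ σ₃) :
      Exec w (.loop c p) σ₁ (T₁ + T₂ + 1) σ₃
  | loop_false {c p σ} (hc : ¬ c.holds σ) : Exec w (.loop c p) σ 1 σ

/-- The initial state: the input words occupy the cells `0, 1, …`, and everything else is `0`. -/
def inputState (l : List ℕ) : RamState where
  reg := fun _ => 0
  mem := fun i => l.getD i 0

/-! ### Parameterized problems and fixed-parameter tractability -/

/-- A decision problem with a two-component parameter, whose instances are given to a machine as
lists of words. -/
structure ParamProblem where
  Inst : Type
  encode : Inst → List ℕ
  param : Inst → ℕ × ℕ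
  yes : Inst → Prop

/-- Some word RAM program decides every instance `x` in at most `f (κ x) * |x| ^ c` steps, where
`f` is computable and `|x|` is the number of words of the input. It has to do so for every word
length `w` such that the input words and the number `f (κ x) * |x| ^ c` fit: apart from what is
needed to store the input words, words of `O(log f (κ x) + log |x|)` bits suffice. The answer
(`1` for yes, `0` for no) is left in register `0`. -/
def ParamProblem.FixedParameterTractable (Q : ParamProblem) : Prop :=
  ∃ (p : RamProg) (f : ℕ × ℕ → ℕ) (c : ℕ), Computable f ∧ 0 < c ∧
    ∀ (x : Q.Inst) (w : ℕ), (∀ a ∈ Q.encode x, a < 2 ^ w) →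
      f (Q.param x) * (Q.encode x).length ^ c < 2 ^ w →
      ∃ (T : ℕ) (τ : RamState), Exec w p (inputState (Q.encode x)) T τ ∧
        T ≤ f (Q.param x) * (Q.encode x).length ^ c ∧
        (Q.yes x → τ.reg 0 = 1) ∧ (¬ Q.yes x → τ.reg 0 = 0)

/-! ### Max-Min Diverse String Set on a `Σ`-DAG -/

/-- An instance: integers `K ≥ 1`, `r ≥ 0`, `Δ ≥ 0` and a `Σ`-DAG `G` with `L(G) ⊆ Σ^r`, with
`n` vertices, over an alphabet of `σ` symbols, given by a list of its labeled edges in any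
order. -/
structure DiverseInstance where
  K : ℕ
  r : ℕ
  Δ : ℕ
  σ : ℕ
  n : ℕ
  G : SigmaDAG (Fin n) (Fin σ)
  edges : List (Fin n × Fin σ × Fin n)
  edges_nodup : edges.Nodup
  mem_edges : ∀ e, e ∈ edges ↔ e ∈ G.E
  one_le_K : 1 ≤ K
  lang_length : ∀ x ∈ G.lang, x.length = r

/-- The input words: a header with `K`, `r`, `Δ`, the alphabet size, the number of vertices, the
number `size(G)` of edges, the source and the sink, then three words for each edge. -/
def DiverseInstance.encode (I : DiverseInstance) : List ℕ :=
  [I.K, I.r, I.Δ, I.σ, I.n, I.edges.length, I.G.s, I.G.t] ++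
    I.edges.flatMap fun e => [(e.1 : ℕ), (e.2.1 : ℕ), (e.2.2 : ℕ)]

/-- The question: is there `X ⊆ L(G)` with `|X| = K` whose Min-diversity is at least `Δ`? -/
def DiverseInstance.yes (I : DiverseInstance) : Prop :=
  ∃ X : Finset (Fin I.r → Fin I.σ),
    (∀ x ∈ X, List.ofFn x ∈ I.G.lang) ∧ X.card = I.K ∧ (I.Δ : ℕ∞) ≤ minDiversity X

/-- Max-Min Diverse String Set on a `Σ`-DAG for `r`-strings, with the parameters `r` and `K`. -/
def maxMinDiverseStringSet : ParamProblem where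
  Inst := DiverseInstance
  encode := DiverseInstance.encode
  param := fun I => (I.r, I.K)
  yes := DiverseInstance.yes

/-!
Strings at distance at least `Δ` are distinct when `Δ` is replaced by `max Δ 1`, so that the
question is whether `L(G)` has `K` strings with pairwise distance at least `max Δ 1`.

*Exchange.* In a solution, one string `x` may be replaced by any string of `L(G)` that avoids the
set `Y` of the position-symbol pairs which the other strings have and `x` does not have: wherever
`x` differs from another string, the new one does too. This set has at most `r * K` elements.

*Representative strings.* A string of `L(G)` that avoids a given set `S` of pairs is found, if there
is one, by reachability in the graph without the edges that `S` forbids (`Net.nx`). If the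
string found meets `Y`, it does so in one of `r` positions; adding that pair to `S` and searching
again gets closer to `Y`, and `S` never leaves `Y`, so that `x` remains as a witness that the next
search succeeds. After at most `r * K` such steps the string found avoids `Y`
(`Net.exists_digits`). Which positions were chosen is recorded by `r * K + 1` digits in
`0, …, r`, where the digit `r` adds nothing to `S`. All strings that arise from such digits are
thus enough to replace a solution, one string after the other (`Net.exists_accepts_iff`), and the
digits for all `K` strings together form a number below `(r + 1) ^ (K * (r * K + 1))`. The algorithm
tries all these numbers, each in polynomial time.

*The machine.* The search is written in a small language whose only loops are counting loops bounded
by parameters that never change (`Cmd`). Therefore a program denotes a total function (`Cmd.eval`),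
about which the correctness proof argues (`eval_search`), and its running time is bounded by an
expression in the parameters (`Cmd.cost`). All operations return at most their first argument, and
array indices are reduced modulo the size of the arrays, so that no overflow and no stray access can
happen. Programs are compiled to the word RAM once and for all in `Cmd.compile_runs`.
-/

set_option linter.constructorNameAsVariable false

namespace LoopRam

/-! ### Running word RAM programs within a time bound -/

/-- On words of `w` bits, the program `p` started in `σ` halts within `B` steps, in a state
satisfying `Q`. -/
def Runs (w : ℕ) (p : RamProg) (σ : RamState) (B : ℕ) (Q : RamState → Prop) : Prop :=
  ∃ T τ, Exec w p σ T τ ∧ T ≤ B ∧ Q τ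

theorem Runs.mono {w p σ B B' Q Q'} (h : Runs w p σ B Q) (hB : B ≤ B') (hQ : ∀ τ, Q τ → Q' τ) :
    Runs w p σ B' Q' := by
  obtain ⟨T, τ, h1, h2, h3⟩ := h
  exact ⟨T, τ, h1, h2.trans hB, hQ τ h3⟩

theorem Runs.seq {w p q σ B₁ B₂ Q} (h : Runs w p σ B₁ fun τ => Runs w q τ B₂ Q) :
    Runs w (.seq p q) σ (B₁ + B₂) Q := by
  obtain ⟨T, τ, h1, h2, T', τ', h3, h4, h5⟩ := h
  exact ⟨_, τ', Exec.seq h1 h3, Nat.add_le_add h2 h4, h5⟩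

theorem Runs.const {w d k σ} {Q : RamState → Prop} (h : k < 2 ^ w) (hQ : Q (σ.setReg d k)) :
    Runs w (.const d k) σ 1 Q :=
  ⟨_, _, Exec.const d k σ h, le_rfl, hQ⟩

theorem Runs.arith {w o d a b σ} {Q : RamState → Prop}
    (h : ArithOp.eval o (σ.reg a) (σ.reg b) < 2 ^ w)
    (hQ : Q (σ.setReg d (ArithOp.eval o (σ.reg a) (σ.reg b)))) :
    Runs w (.arith o d a b) σ 1 Q :=
  ⟨_, _, Exec.arith o d a b σ h, le_rfl, hQ⟩

theorem Runs.load {w d a σ} {Q : RamState → Prop} (hQ : Q (σ.setReg d (σ.mem (σ.reg a)))) :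
    Runs w (.load d a) σ 1 Q :=
  ⟨_, _, Exec.load d a σ, le_rfl, hQ⟩

theorem Runs.store {w a b σ} {Q : RamState → Prop}
    (hQ : Q (σ.setMem (σ.reg a) (σ.reg b))) : Runs w (.store a b) σ 1 Q :=
  ⟨_, _, Exec.store a b σ, le_rfl, hQ⟩

theorem Runs.ite {w c p q σ B₁ B₂ Q} (hp : c.holds σ → Runs w p σ B₁ Q)
    (hq : ¬ c.holds σ → Runs w q σ B₂ Q) : Runs w (.ite c p q) σ (B₁ + B₂ + 1) Q := by
  by_cases hc : c.holds σ
  · obtain ⟨T, τ, h1, h2, h3⟩ := hp hc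
    exact ⟨_, τ, Exec.ite_true hc h1, by omega, h3⟩
  · obtain ⟨T, τ, h1, h2, h3⟩ := hq hc
    exact ⟨_, τ, Exec.ite_false hc h1, by omega, h3⟩

/-- A loop that is left after exactly `n` passes, with an invariant indexed by the number of
passes made. -/
theorem Runs.loop {w c p σ B} (n : ℕ) (Inv : ℕ → RamState → Prop) (h0 : Inv 0 σ)
    (hstep : ∀ i < n, ∀ τ, Inv i τ → c.holds τ ∧ Runs w p τ B (Inv (i + 1)))
    (hend : ∀ τ, Inv n τ → ¬ c.holds τ) :
    Runs w (.loop c p) σ (n * (B + 1) + 1) (Inv n) := by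
  suffices H : ∀ k i σ, i + k = n → Inv i σ → Runs w (.loop c p) σ (k * (B + 1) + 1) (Inv n) from
    H n 0 σ (by omega) h0
  intro k
  induction k with
  | zero =>
    intro i σ hi hI
    obtain rfl : i = n := by omega
    exact ⟨1, σ, Exec.loop_false (hend σ hI), by omega, hI⟩
  | succ k ih =>
    intro i σ hi hI
    obtain ⟨hc, T, τ, h1, h2, h3⟩ := hstep i (by omega) σ hI
    obtain ⟨T', τ', h4, h5, h6⟩ := ih (i + 1) τ (by omega) h3
    refine ⟨_, τ', Exec.loop_true hc h1 h4, ?_, h6⟩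
    rw [Nat.succ_mul]
    omega

@[simp] theorem setReg_reg (σ : RamState) (d x y : ℕ) :
    (σ.setReg d x).reg y = if y = d then x else σ.reg y := by
  simp [RamState.setReg, Function.update_apply]

@[simp] theorem setReg_mem (σ : RamState) (d x : ℕ) : (σ.setReg d x).mem = σ.mem := rfl

@[simp] theorem setMem_mem (σ : RamState) (a x y : ℕ) :
    (σ.setMem a x).mem y = if y = a then x else σ.mem y := by
  simp [RamState.setMem, Function.update_apply]

/-! ### A language of bounded loops -/

/-- Read-only parameters: the size `P × stride` of each array and the address `base` where the
arrays start; the data `K`, `r`, `Δ`, `M` (the number of edges), `s` and `t` of the instance; the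
number `q` of digits used for one string and the number `N` of digit sequences to be tried. -/
inductive Par
  | stride | P | base | K | r | Δ | M | s | t | q | N
  deriving DecidableEq

/-- The mutable variables: the answer `ans`, the number `z` on trial and what is left of it, `y`,
the flag `ok`, counters, and auxiliary variables. -/
inductive Var
  | ans | z | y | ok | k | e | i | j | d | a | v | c | h | l
  deriving DecidableEq

/-- The two-dimensional arrays: `ban` is indexed by an edge and a position, `nx` by a vertex and the
number of edges left to the sink, `str` by the number of a string and a position. -/
inductive Arr
  | ban | nx | str
  deriving DecidableEq

/-- What a run cannot change: the parameters and the input cells. -/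
structure Env where
  par : Par → ℕ
  inp : ℕ → ℕ

/-- The state of a run: the variables and the arrays. -/
structure HState where
  v : Var → ℕ
  a : Arr → ℕ → ℕ → ℕ

/-- Assign `n` to the variable `x`. -/
def HState.set (ρ : HState) (x : Var) (n : ℕ) : HState :=
  { ρ with v := Function.update ρ.v x n }

/-- Assign `n` to the entry `(i, j)` of the array `u`. -/
def HState.put (ρ : HState) (u : Arr) (i j n : ℕ) : HState :=
  { ρ with a := fun u' i' j' => if u' = u ∧ i' = i ∧ j' = j then n else ρ.a u' i' j' }

@[simp] theorem HState.set_v (ρ : HState) (x : Var) (n : ℕ) (y : Var) :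
    (ρ.set x n).v y = if y = x then n else ρ.v y := by
  simp [HState.set, Function.update_apply]

@[simp] theorem HState.set_a (ρ : HState) (x : Var) (n : ℕ) : (ρ.set x n).a = ρ.a := rfl

@[simp] theorem HState.put_v (ρ : HState) (u : Arr) (i j n : ℕ) : (ρ.put u i j n).v = ρ.v := rfl

@[simp] theorem HState.put_a (ρ : HState) (u : Arr) (i j n : ℕ) (u' : Arr) (i' j' : ℕ) :
    (ρ.put u i j n).a u' i' j' = if u' = u ∧ i' = i ∧ j' = j then n else ρ.a u' i' j' := rfl

/-- Expressions. Every operation returns at most its first argument and array indices are reduced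
modulo the size of the array, so that an evaluation never leaves the range of a word or the
memory set aside. -/
inductive Ex
  | var (x : Var)
  | par (p : Par)
  | lit (c : Fin 2)
  | op (o : ArithOp) (h : ∀ a b, o.eval a b ≤ a) (a b : Ex)
  /-- an array entry -/
  | get (u : Arr) (a b : Ex)
  /-- the `c`-th word (tail, label, head) of the edge with the given number -/
  | inp (c : Fin 3) (a : Ex)

/-- The `c`-th word of the edge number `e`, in the input; the edges start at cell `8`. -/
def Env.word (E : Env) (c : Fin 3) (e : ℕ) : ℕ :=
  E.inp (8 + 3 * (e % E.par .P) + c)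

/-- The value of an expression. -/
def Ex.val (E : Env) (ρ : HState) : Ex → ℕ
  | var x => ρ.v x
  | par p => E.par p
  | lit c => c
  | op o _ a b => o.eval (a.val E ρ) (b.val E ρ)
  | get u a b => ρ.a u (a.val E ρ % E.par .P) (b.val E ρ % E.par .stride)
  | inp c a => E.word c (a.val E ρ)

/-- Comparisons of two values. -/
inductive Cmp
  | lt | eq

def Cmp.holds : Cmp → ℕ → ℕ → Prop
  | lt, a, b => a < b
  | eq, a, b => a = b

instance (c : Cmp) (a b : ℕ) : Decidable (c.holds a b) := by
  cases c <;> unfold Cmp.holds <;> infer_instance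

/-- Programs. The only loops are counting loops, bounded by a parameter. -/
inductive Cmd
  | skip
  | set (x : Var) (e : Ex)
  | put (u : Arr) (i j e : Ex)
  | seq (p q : Cmd)
  | ite (c : Cmp) (a b : Ex) (p q : Cmd)
  /-- for `x = 0, 1, …, b - 1` do `p` -/
  | count (x : Var) (b : Par) (p : Cmd)

/-- The effect of a program. As there are only counting loops, it is a total function. -/
def Cmd.eval (E : Env) : Cmd → HState → HState
  | skip, ρ => ρ
  | set x e, ρ => ρ.set x (e.val E ρ)
  | put u i j e, ρ =>
      ρ.put u (i.val E ρ % E.par .P) (j.val E ρ % E.par .stride) (e.val E ρ)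
  | seq p q, ρ => q.eval E (p.eval E ρ)
  | ite c a b p q, ρ => if c.holds (a.val E ρ) (b.val E ρ) then p.eval E ρ else q.eval E ρ
  | .count x b p, ρ =>
      Nat.rec (ρ.set x 0) (fun i ρ' => (p.eval E ρ').set x (i + 1)) (E.par b)

/-- The variables a program may change. -/
def Cmd.writes : Cmd → Var → Bool
  | skip, _ => false
  | set x _, y => decide (y = x)
  | put _ _ _ _, _ => false
  | seq p q, y => p.writes y || q.writes y
  | ite _ _ _ p q, y => p.writes y || q.writes y
  | .count x _ p, y => decide (y = x) || p.writes y

/-- The arrays a program may change. -/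
def Cmd.puts : Cmd → Arr → Bool
  | skip, _ => false
  | set _ _, _ => false
  | put u _ _ _, u' => decide (u' = u)
  | seq p q, u => p.puts u || q.puts u
  | ite _ _ _ p q, u => p.puts u || q.puts u
  | .count _ _ p, u => p.puts u

/-- The body of a counting loop does not change the counter. -/
def Cmd.wf : Cmd → Bool
  | skip => true
  | set _ _ => true
  | put _ _ _ _ => true
  | seq p q => p.wf && q.wf
  | ite _ _ _ p q => p.wf && q.wf
  | .count x _ p => !p.writes x && p.wf

theorem Cmd.eval_seq (E : Env) (p q : Cmd) (ρ : HState) :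
    (seq p q).eval E ρ = q.eval E (p.eval E ρ) := rfl

theorem Cmd.eval_ite (E : Env) (c : Cmp) (a b : Ex) (p q : Cmd) (ρ : HState) :
    (ite c a b p q).eval E ρ =
      if c.holds (a.val E ρ) (b.val E ρ) then p.eval E ρ else q.eval E ρ := rfl

/-- A program leaves all variables alone that it does not mention as targets. -/
theorem Cmd.eval_v (E : Env) (p : Cmd) (ρ : HState) {y : Var} (h : p.writes y = false) :
    (p.eval E ρ).v y = ρ.v y := by
  induction p generalizing ρ with
  | skip => rfl
  | set x e => simp_all [Cmd.eval, Cmd.writes]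
  | put => rfl
  | seq p q ihp ihq =>
    simp only [Cmd.writes, Bool.or_eq_false_iff] at h
    rw [Cmd.eval, ihq _ h.2, ihp _ h.1]
  | ite c a b p q ihp ihq =>
    simp only [Cmd.writes, Bool.or_eq_false_iff] at h
    simp only [Cmd.eval]
    split
    · exact ihp _ h.1
    · exact ihq _ h.2
  | count x b p ih =>
    simp only [Cmd.writes, Bool.or_eq_false_iff, decide_eq_false_iff_not] at h
    simp only [Cmd.eval]
    generalize E.par b = n
    induction n with
    | zero => simp [h.1]
    | succ n ihn => simp [h.1, ih _ h.2, ihn]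

/-- A program leaves all arrays alone that it does not mention as targets. -/
theorem Cmd.eval_a (E : Env) (p : Cmd) (ρ : HState) {u : Arr} (h : p.puts u = false) :
    (p.eval E ρ).a u = ρ.a u := by
  induction p generalizing ρ with
  | skip => rfl
  | set x e => rfl
  | put => funext i j; simp_all [Cmd.eval, Cmd.puts]
  | seq p q ihp ihq =>
    simp only [Cmd.puts, Bool.or_eq_false_iff] at h
    rw [Cmd.eval, ihq _ h.2, ihp _ h.1]
  | ite c a b p q ihp ihq =>
    simp only [Cmd.puts, Bool.or_eq_false_iff] at h
    simp only [Cmd.eval]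
    split
    · exact ihp _ h.1
    · exact ihq _ h.2
  | count x b p ih =>
    simp only [Cmd.puts] at h
    simp only [Cmd.eval]
    generalize E.par b = n
    induction n with
    | zero => rfl
    | succ n ihn => rw [HState.set_a, ih _ h, ihn]

/-- The invariant rule for counting loops. In each pass, the counter is known and the variables that
the loop does not write have their initial values. -/
theorem Cmd.eval_count {E : Env} {x : Var} {b : Par} {p : Cmd} {ρ : HState}
    (Inv : ℕ → HState → Prop) (h0 : Inv 0 (ρ.set x 0))
    (hs : ∀ n ρ', n < E.par b → ρ'.v x = n → (∀ y, (Cmd.count x b p).writes y = false →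
      ρ'.v y = ρ.v y) → Inv n ρ' → Inv (n + 1) ((p.eval E ρ').set x (n + 1))) :
    Inv (E.par b) ((Cmd.count x b p).eval E ρ) := by
  simp only [Cmd.eval]
  suffices H : ∀ n ≤ E.par b, ∀ ρ', ρ' = (Nat.rec (ρ.set x 0)
      (fun i ρ' => (p.eval E ρ').set x (i + 1)) n : HState) →
      (ρ'.v x = n ∧ ∀ y, (Cmd.count x b p).writes y = false → ρ'.v y = ρ.v y) ∧ Inv n ρ' from
    (H _ le_rfl _ rfl).2
  intro n
  induction n with
  | zero =>
    rintro - _ rfl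
    refine ⟨⟨by simp, fun y hy => ?_⟩, h0⟩
    simp only [Cmd.writes, Bool.or_eq_false_iff, decide_eq_false_iff_not] at hy
    simp [hy.1]
  | succ n ih =>
    rintro hn _ rfl
    obtain ⟨⟨h1, h2⟩, h3⟩ := ih (by omega) _ rfl
    refine ⟨⟨by simp, fun y hy => ?_⟩, hs n _ (by omega) h1 h2 h3⟩
    rw [← h2 y hy]
    simp only [Cmd.writes, Bool.or_eq_false_iff, decide_eq_false_iff_not] at hy
    simp [hy.1, Cmd.eval_v E p _ hy.2]

/-! ### Compilation to the word RAM -/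

/-- The register of a variable; the answer is in register `0`. -/
def Var.reg : Var → ℕ
  | ans => 0 | z => 1 | y => 2 | ok => 3 | k => 4 | e => 5 | i => 6 | j => 7 | d => 8 | a => 9
  | v => 10 | c => 11 | h => 12 | l => 13

/-- The register of a parameter; the registers from `32` on are for intermediate results. -/
def Par.reg : Par → ℕ
  | stride => 16 | P => 17 | base => 18 | K => 19 | r => 20 | Δ => 21 | M => 22 | s => 23
  | t => 24 | q => 25 | N => 26

/-- The position of an array in the interleaved layout. -/
def Arr.idx : Arr → ℕ
  | ban => 0 | nx => 1 | str => 2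

theorem Var.reg_lt (x : Var) : x.reg < 16 := by cases x <;> decide
theorem Par.le_reg (x : Par) : 16 ≤ x.reg := by cases x <;> decide
theorem Par.reg_lt (x : Par) : x.reg < 32 := by cases x <;> decide
theorem Var.reg_inj {x y : Var} : x.reg = y.reg ↔ x = y := by
  constructor
  · cases x <;> cases y <;> simp [Var.reg]
  · rintro rfl; rfl
theorem Arr.idx_lt (x : Arr) : x.idx < 3 := by cases x <;> decide
theorem Arr.idx_inj {x y : Arr} : x.idx = y.idx ↔ x = y := by
  constructor
  · cases x <;> cases y <;> simp [Arr.idx]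
  · rintro rfl; rfl

/-- With two indices in the registers `d` and `d + 1`, put the address of the array entry into
register `d`. The arrays are interleaved: consecutive cells belong to different arrays. -/
def addrProg (u : Arr) (d : ℕ) : RamProg :=
  .seq (.arith .mod d d Par.P.reg) <| .seq (.arith .mul d d Par.stride.reg) <|
  .seq (.arith .mod (d + 1) (d + 1) Par.stride.reg) <| .seq (.arith .add d d (d + 1)) <|
  .seq (.const (d + 1) 3) <| .seq (.arith .mul d d (d + 1)) <|
  .seq (.const (d + 1) u.idx) <| .seq (.arith .add d d (d + 1)) <|
  .arith .add d d Par.base.reg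

/-- The address of an array entry. -/
def Env.addr (E : Env) (u : Arr) (i j : ℕ) : ℕ :=
  (i * E.par .stride + j) * 3 + u.idx + E.par .base

/-- Code that leaves the value of an expression in register `d` and uses only the registers from
`d` on. -/
def Ex.compile : Ex → ℕ → RamProg
  | var x, d => .seq (.const d 0) (.arith .add d x.reg d)
  | par p, d => .seq (.const d 0) (.arith .add d p.reg d)
  | lit c, d => .const d c
  | op o _ a b, d => .seq (a.compile d) (.seq (b.compile (d + 1)) (.arith o d d (d + 1)))
  | get u a b, d => .seq (a.compile d) (.seq (b.compile (d + 1)) (.seq (addrProg u d) (.load d d)))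
  | inp c a, d =>
      .seq (a.compile d) <| .seq (.arith .mod d d Par.P.reg) <| .seq (.const (d + 1) 3) <|
      .seq (.arith .mul d d (d + 1)) <| .seq (.const (d + 1) (8 + c)) <|
      .seq (.arith .add d d (d + 1)) (.load d d)

def Cmp.test : Cmp → ℕ → ℕ → RegTest
  | lt, a, b => .lt a b
  | eq, a, b => .eq a b

def Cmd.compile : Cmd → RamProg
  | skip => .skip
  | set x e => .seq (e.compile 32) (.seq (.const 33 0) (.arith .add x.reg 32 33))
  | put u i j e => .seq (i.compile 32) (.seq (j.compile 33) (.seq (addrProg u 32)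
      (.seq (e.compile 33) (.store 32 33))))
  | seq p q => .seq p.compile q.compile
  | ite c a b p q => .seq (a.compile 32) (.seq (b.compile 33)
      (.ite (c.test 32 33) p.compile q.compile))
  | .count x b p => .seq (.const x.reg 0) (.loop (.lt x.reg b.reg)
      (.seq p.compile (.seq (.const 32 1) (.arith .add x.reg x.reg 32))))

/-- The number of steps of a compiled expression. -/
def Ex.cost : Ex → ℕ
  | var _ => 2
  | par _ => 2
  | lit _ => 1
  | op _ _ a b => a.cost + (b.cost + 1)
  | get _ a b => a.cost + (b.cost + (9 + 1))
  | inp _ a => a.cost + 6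

/-- A bound on the number of steps of a compiled program, which depends on the parameters only. -/
def Cmd.cost (π : Par → ℕ) : Cmd → ℕ
  | skip => 1
  | set _ e => e.cost + 2
  | put _ i j e => i.cost + (j.cost + (9 + (e.cost + 1)))
  | seq p q => p.cost π + q.cost π
  | ite _ a b p q => a.cost + (b.cost + (p.cost π + q.cost π + 1))
  | .count _ b p => 1 + (π b * (p.cost π + 2 + 1) + 1)

/-- The environment fits into a machine with words of `w` bits, including all addresses. -/
structure Env.Fits (E : Env) (w : ℕ) : Prop where
  lit : 16 < 2 ^ w
  par : ∀ p, E.par p < 2 ^ w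
  inp : ∀ m, E.inp m < 2 ^ w
  posP : 0 < E.par .P
  pos_stride : 0 < E.par .stride
  base : E.par .base = 8 + 3 * E.par .P
  addr : E.par .base + 3 * (E.par .P * E.par .stride) < 2 ^ w

/-- All numbers stored in a state are words. -/
def HState.Fits (ρ : HState) (w : ℕ) : Prop :=
  (∀ x, ρ.v x < 2 ^ w) ∧ ∀ u i j, ρ.a u i j < 2 ^ w

/-- A state of the machine represents a state of a run. The cells below `base` hold the input, which
is followed by zeros up to `base`. -/
structure Rep (E : Env) (ρ : HState) (σ : RamState) : Prop where
  var : ∀ x : Var, σ.reg x.reg = ρ.v x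
  par : ∀ p : Par, σ.reg p.reg = E.par p
  arr : ∀ u i j, i < E.par .P → j < E.par .stride → σ.mem (E.addr u i j) = ρ.a u i j
  inp : ∀ m < E.par .base, σ.mem m = E.inp m

theorem Rep.congr {E ρ σ τ} (h : Rep E ρ σ) (hreg : ∀ x < 32, τ.reg x = σ.reg x)
    (hmem : τ.mem = σ.mem) : Rep E ρ τ where
  var x := by rw [hreg _ (by have := x.reg_lt; omega), h.var]
  par p := by rw [hreg _ p.reg_lt, h.par]
  arr u i j hi hj := by rw [hmem, h.arr u i j hi hj]
  inp m hm := by rw [hmem, h.inp m hm]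

theorem Env.idx_lt {E : Env} {i j : ℕ} (hi : i < E.par .P) (hj : j < E.par .stride) :
    i * E.par .stride + j < E.par .P * E.par .stride := by
  have := Nat.mul_le_mul_right (E.par .stride) (Nat.succ_le_of_lt hi)
  rw [Nat.succ_mul] at this
  omega

theorem Env.addr_inj {E : Env} {u i j u' i' j'} (hj : j < E.par .stride)
    (hj' : j' < E.par .stride) :
    E.addr u i j = E.addr u' i' j' ↔ u = u' ∧ i = i' ∧ j = j' := by
  constructor
  · intro h
    have h3 := u.idx_lt
    have h4 := u'.idx_lt
    unfold Env.addr at h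
    have hu : u.idx = u'.idx := by omega
    have hij : i * E.par .stride + j = i' * E.par .stride + j' := by omega
    have hi : i = i' := by
      have := congrArg (· / E.par .stride) hij
      simpa [Nat.add_div_of_dvd_right, Nat.mul_add_div, Nat.add_comm _ j, Nat.add_comm _ j',
        Nat.add_mul_div_right _ _ (show 0 < E.par .stride by omega), Nat.div_eq_of_lt hj,
        Nat.div_eq_of_lt hj'] using this
    subst hi
    exact ⟨Arr.idx_inj.1 hu, rfl, by omega⟩
  · rintro ⟨rfl, rfl, rfl⟩; rfl

theorem addrProg_runs {E : Env} {w : ℕ} (hE : E.Fits w) {u : Arr} {d : ℕ} (hd : 32 ≤ d)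
    {σ : RamState} (hp : ∀ p : Par, σ.reg p.reg = E.par p) :
    Runs w (addrProg u d) σ 9 fun τ =>
      τ.reg d = E.addr u (σ.reg d % E.par .P) (σ.reg (d + 1) % E.par .stride) ∧
      τ.mem = σ.mem ∧ ∀ x < d, τ.reg x = σ.reg x := by
  have hP := Par.P.reg_lt
  have hS := Par.stride.reg_lt
  have hL := Par.base.reg_lt
  have hp1 := hp .P
  have hp2 := hp .stride
  have hp3 := hp .base
  generalize hx : σ.reg d % E.par .P = x
  generalize hy : σ.reg (d + 1) % E.par .stride = y
  have hxP : x < E.par .P := hx ▸ Nat.mod_lt _ hE.posP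
  have hyS : y < E.par .stride := hy ▸ Nat.mod_lt _ hE.pos_stride
  have h1 := Env.idx_lt hxP hyS
  have h2 := hE.addr
  have h3 := u.idx_lt
  have h4 := hE.lit
  have h5 := hE.par .P
  have h6 := hE.par .stride
  have e1 : Par.P.reg ≠ d := by omega
  have e2 : Par.stride.reg ≠ d := by omega
  have e3 : Par.base.reg ≠ d := by omega
  have e1' : Par.P.reg ≠ d + 1 := by omega
  have e2' : Par.stride.reg ≠ d + 1 := by omega
  have e3' : Par.base.reg ≠ d + 1 := by omega
  unfold addrProg
  refine Runs.mono (B := 1 + (1 + (1 + (1 + (1 + (1 + (1 + (1 + 1)))))))) (Q := fun τ =>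
    τ.reg d = E.addr u x y ∧ τ.mem = σ.mem ∧ ∀ x < d, τ.reg x = σ.reg x) ?_ (by omega)
    (fun _ h => h)
  refine Runs.seq (Runs.arith ?_ (Runs.seq (Runs.arith ?_ (Runs.seq (Runs.arith ?_ (Runs.seq
    (Runs.arith ?_ (Runs.seq (Runs.const ?_ (Runs.seq (Runs.arith ?_ (Runs.seq (Runs.const ?_
    (Runs.seq (Runs.arith ?_ (Runs.arith ?_ ?_)))))))))))))))) <;>
  try simp [ArithOp.eval, *, Env.addr]
  any_goals omega
  intro z hz
  simp [Nat.ne_of_lt hz, show z ≠ d + 1 by omega]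

theorem Ex.val_lt {E : Env} {w : ℕ} (hE : E.Fits w) {ρ : HState} (hρ : ρ.Fits w) (e : Ex) :
    e.val E ρ < 2 ^ w := by
  induction e with
  | var x => exact hρ.1 x
  | par p => exact hE.par p
  | lit c => have := hE.lit; simp only [Ex.val]; omega
  | op o h a b iha ihb => exact (h _ _).trans_lt iha
  | get u a b => exact hρ.2 _ _ _
  | inp c a => exact hE.inp _

/-- The code of an expression computes its value and preserves the memory and the lower
registers. -/
theorem Ex.compile_runs {E : Env} {w : ℕ} (hE : E.Fits w) {ρ : HState} (hρ : ρ.Fits w) (e : Ex)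
    {d : ℕ} (hd : 32 ≤ d) {σ : RamState} (hR : Rep E ρ σ) :
    Runs w (e.compile d) σ e.cost fun τ =>
      τ.reg d = e.val E ρ ∧ τ.mem = σ.mem ∧ ∀ x < d, τ.reg x = σ.reg x := by
  have hlit := hE.lit
  induction e generalizing d σ with
  | var x =>
    have hx := x.reg_lt
    have h1 := hρ.1 x
    refine Runs.seq (B₁ := 1) (B₂ := 1) (Runs.const (by omega) (Runs.arith ?_ ?_))
    · simp [ArithOp.eval, hR.var, show x.reg ≠ d by omega, h1]
    · simp only [ArithOp.eval, setReg_reg, setReg_mem, Ex.val]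
      simp +contextual [show x.reg ≠ d by omega, hR.var, Nat.ne_of_lt]
  | par p =>
    have hx := p.reg_lt
    have h1 := hE.par p
    refine Runs.seq (B₁ := 1) (B₂ := 1) (Runs.const (by omega) (Runs.arith ?_ ?_))
    · simp [ArithOp.eval, hR.par, show p.reg ≠ d by omega, h1]
    · simp only [ArithOp.eval, setReg_reg, setReg_mem, Ex.val]
      simp +contextual [show p.reg ≠ d by omega, hR.par, Nat.ne_of_lt]
  | lit c =>
    refine Runs.const (by omega) ?_
    simp +contextual [Ex.val, Nat.ne_of_lt]
  | op o h a b iha ihb =>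
    refine Runs.seq ((iha hd hR).mono le_rfl ?_)
    rintro τ ⟨h1, h2, h3⟩
    refine Runs.seq ((ihb (d := d + 1) (by omega)
      (hR.congr (fun x hx => h3 x (by omega)) h2)).mono le_rfl ?_)
    rintro υ ⟨h4, h5, h6⟩
    refine Runs.arith ?_ ?_
    · rw [h4, h6 d (by omega), h1]
      exact (h _ _).trans_lt (Ex.val_lt hE hρ a)
    · refine ⟨by simp [h4, h6 d (by omega), h1, Ex.val], by simp [h5, h2], fun x hx => ?_⟩
      simp [Nat.ne_of_lt hx, h6 x (by omega), h3 x hx]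
  | get u a b iha ihb =>
    refine Runs.seq ((iha hd hR).mono le_rfl ?_)
    rintro τ ⟨h1, h2, h3⟩
    have hRτ : Rep E ρ τ := hR.congr (fun x hx => h3 x (by omega)) h2
    refine Runs.seq ((ihb (d := d + 1) (by omega) hRτ).mono le_rfl ?_)
    rintro υ ⟨h4, h5, h6⟩
    have hRυ : Rep E ρ υ := hRτ.congr (fun x hx => h6 x (by omega)) h5
    refine Runs.seq ((addrProg_runs hE hd hRυ.par).mono le_rfl ?_)
    rintro φ ⟨h7, h8, h9⟩
    refine Runs.load ⟨?_, by simp [h8, h5, h2], fun x hx => ?_⟩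
    · rw [setReg_reg, if_pos rfl, h7, h8, hRυ.arr _ _ _ (Nat.mod_lt _ hE.posP)
        (Nat.mod_lt _ hE.pos_stride), h4, h6 d (by omega), h1]
      rfl
    · simp [Nat.ne_of_lt hx, h9 x hx, h6 x (by omega), h3 x hx]
  | inp c a iha =>
    refine Runs.seq ((iha hd hR).mono le_rfl ?_)
    rintro τ ⟨h1, h2, h3⟩
    have hRτ : Rep E ρ τ := hR.congr (fun x hx => h3 x (by omega)) h2
    have hP := Par.P.reg_lt
    have hp := hRτ.par .P
    have hm : a.val E ρ % E.par .P < E.par .P := Nat.mod_lt _ hE.posP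
    have hb := hE.base
    have hb' := hE.par .base
    have hc := c.isLt
    have hl := hRτ.inp (8 + 3 * (a.val E ρ % E.par .P) + c) (by omega)
    refine Runs.mono (B := 1 + (1 + (1 + (1 + (1 + 1))))) (Runs.seq (Runs.arith ?_ (Runs.seq
      (Runs.const ?_ (Runs.seq (Runs.arith ?_ (Runs.seq (Runs.const ?_ (Runs.seq (Runs.arith ?_
      (Runs.load (Q := fun τ => τ.reg d = (Ex.inp c a).val E ρ ∧ τ.mem = σ.mem ∧
        ∀ x < d, τ.reg x = σ.reg x) ?_)))))))))))
      (by omega) (fun _ h => h)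
    · simp only [ArithOp.eval, h1, hp]; omega
    · omega
    · simp [ArithOp.eval, h1, hp]; omega
    · omega
    · simp [ArithOp.eval, h1, hp]; omega
    · refine ⟨?_, by simp [h2], fun x hx => ?_⟩
      · simp only [ArithOp.eval, setReg_reg, setReg_mem, h1, hp]
        simp [Ex.val, Env.word, ← hl]
        congr 1
        omega
      · simp [Nat.ne_of_lt hx, show x ≠ d + 1 by omega, h3 x hx]

theorem HState.Fits.set {ρ : HState} {w} (h : ρ.Fits w) {x n} (hn : n < 2 ^ w) :
    (ρ.set x n).Fits w := by
  refine ⟨fun y => ?_, h.2⟩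
  rw [HState.set_v]
  split
  · exact hn
  · exact h.1 y

theorem HState.Fits.put {ρ : HState} {w} (h : ρ.Fits w) {u i j n} (hn : n < 2 ^ w) :
    (ρ.put u i j n).Fits w := by
  refine ⟨h.1, fun u' i' j' => ?_⟩
  rw [HState.put_a]
  split
  · exact hn
  · exact h.2 _ _ _

theorem Rep.set {E ρ σ τ} (h : Rep E ρ σ) (x : Var) {n : ℕ}
    (hreg : ∀ y < 32, τ.reg y = if y = x.reg then n else σ.reg y)
    (hmem : τ.mem = σ.mem) : Rep E (ρ.set x n) τ where
  var y := by
    have := y.reg_lt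
    rw [hreg _ (by omega), HState.set_v, h.var]
    simp [Var.reg_inj]
  par p := by
    have := x.reg_lt
    have := p.le_reg
    rw [hreg _ p.reg_lt, if_neg (by omega), h.par]
  arr u i j hi hj := by rw [hmem, h.arr u i j hi hj]; rfl
  inp m hm := by rw [hmem, h.inp m hm]

theorem Cmp.test_holds {c : Cmp} {a b : ℕ} {σ : RamState} :
    (c.test a b).holds σ ↔ c.holds (σ.reg a) (σ.reg b) := by
  cases c <;> rfl

/-- A compiled program has the effect of the program, within the predicted time. -/
theorem Cmd.compile_runs {E : Env} {w : ℕ} (hE : E.Fits w) (p : Cmd) (hwf : p.wf = true)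
    {ρ : HState} (hρ : ρ.Fits w) {σ : RamState} (hR : Rep E ρ σ) :
    Runs w p.compile σ (p.cost E.par) fun τ => Rep E (p.eval E ρ) τ ∧ (p.eval E ρ).Fits w := by
  have hlit := hE.lit
  induction p generalizing ρ σ with
  | skip => exact ⟨1, σ, Exec.skip σ, le_rfl, hR, hρ⟩
  | set x e =>
    have hx := x.reg_lt
    have hv := Ex.val_lt hE hρ e
    refine Runs.seq (B₂ := 1 + 1) ((e.compile_runs hE hρ le_rfl hR).mono le_rfl ?_)
    rintro τ ⟨h1, h2, h3⟩
    refine Runs.seq (Runs.const (by omega) (Runs.arith ?_ ⟨?_, hρ.set hv⟩))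
    · simpa [ArithOp.eval, h1] using hv
    · refine hR.set x (fun y hy => ?_) (by simp [h2])
      simp [ArithOp.eval, h1, show y ≠ 33 by omega, h3 y hy]
  | put u i j e =>
    have hv := Ex.val_lt hE hρ e
    refine Runs.seq ((i.compile_runs hE hρ le_rfl hR).mono le_rfl ?_)
    rintro τ ⟨h1, h2, h3⟩
    have hRτ : Rep E ρ τ := hR.congr h3 h2
    refine Runs.seq ((j.compile_runs hE hρ (d := 33) (by omega) hRτ).mono le_rfl ?_)
    rintro υ ⟨h4, h5, h6⟩
    have hRυ : Rep E ρ υ := hRτ.congr (fun x hx => h6 x (by omega)) h5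
    refine Runs.seq ((addrProg_runs hE le_rfl hRυ.par).mono le_rfl ?_)
    rintro φ ⟨h7, h8, h9⟩
    have hRφ : Rep E ρ φ := hRυ.congr h9 h8
    rw [h4, h6 32 (by omega), h1] at h7
    refine Runs.seq ((e.compile_runs hE hρ (d := 33) (by omega) hRφ).mono le_rfl ?_)
    rintro ψ ⟨h10, h11, h12⟩
    have hRψ : Rep E ρ ψ := hRφ.congr (fun x hx => h12 x (by omega)) h11
    have hi : i.val E ρ % E.par .P < E.par .P := Nat.mod_lt _ hE.posP
    have hj : j.val E ρ % E.par .stride < E.par .stride := Nat.mod_lt _ hE.pos_stride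
    refine Runs.store ⟨⟨hRψ.var, hRψ.par, fun u' i' j' hi' hj' => ?_, fun m hm => ?_⟩, hρ.put hv⟩
    · rw [setMem_mem, h12 32 (by omega), h7, h10, hRψ.arr u' i' j' hi' hj']
      simp [Cmd.eval, Env.addr_inj hj' hj]
    · rw [setMem_mem, h12 32 (by omega), h7, if_neg, hRψ.inp m hm]
      unfold Env.addr
      omega
  | seq p q ihp ihq =>
    simp only [Cmd.wf, Bool.and_eq_true] at hwf
    refine Runs.seq ((ihp hwf.1 hρ hR).mono le_rfl ?_)
    rintro τ ⟨h1, h2⟩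
    exact ihq hwf.2 h2 h1
  | ite c a b p q ihp ihq =>
    simp only [Cmd.wf, Bool.and_eq_true] at hwf
    refine Runs.seq ((a.compile_runs hE hρ le_rfl hR).mono le_rfl ?_)
    rintro τ ⟨h1, h2, h3⟩
    have hRτ : Rep E ρ τ := hR.congr h3 h2
    refine Runs.seq ((b.compile_runs hE hρ (d := 33) (by omega) hRτ).mono le_rfl ?_)
    rintro υ ⟨h4, h5, h6⟩
    have hRυ : Rep E ρ υ := hRτ.congr (fun x hx => h6 x (by omega)) h5
    refine Runs.ite (fun hc => ?_) (fun hc => ?_) <;>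
      rw [Cmp.test_holds, h4, h6 32 (by omega), h1] at hc
    · simp only [Cmd.eval, if_pos hc]
      exact ihp hwf.1 hρ hRυ
    · simp only [Cmd.eval, if_neg hc]
      exact ihq hwf.2 hρ hRυ
  | count x b p ih =>
    simp only [Cmd.wf, Bool.and_eq_true, Bool.not_eq_true'] at hwf
    have hx := x.reg_lt
    have hb' := b.le_reg
    refine Runs.seq (Runs.const (by omega) ?_)
    simp only [Cmd.eval]
    refine (Runs.loop (E.par b) (fun n τ => ∀ ρ', ρ' = (Nat.rec (ρ.set x 0)
      (fun i ρ' => (p.eval E ρ').set x (i + 1)) n : HState) →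
      ρ'.v x = n ∧ Rep E ρ' τ ∧ ρ'.Fits w) ?_ ?_ ?_).mono le_rfl ?_
    · rintro _ rfl
      exact ⟨by simp, hR.set x (fun y _ => by simp) (by simp), hρ.set (by omega)⟩
    · intro i hi τ hτ
      obtain ⟨h1, h2, h3⟩ := hτ _ rfl
      refine ⟨?_, ?_⟩
      · simp only [RegTest.holds, h2.var, h2.par, h1, hi]
      · refine Runs.seq (B₂ := 1 + 1) ((ih hwf.2 h3 h2).mono le_rfl ?_)
        rintro υ ⟨h4, h5⟩
        have hp := hE.par b
        have hxv : υ.reg x.reg = i := by rw [h4.var, Cmd.eval_v E p _ hwf.1, h1]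
        refine Runs.seq (Runs.const (by omega) (Runs.arith ?_ ?_))
        · simp [ArithOp.eval, show x.reg ≠ 32 by omega, hxv]
          omega
        · rintro _ rfl
          refine ⟨by simp, h4.set x (fun y hy => ?_) (by simp), h5.set (by omega)⟩
          simp [ArithOp.eval, show x.reg ≠ 32 by omega, show y ≠ 32 by omega, hxv]
    · intro τ hτ
      obtain ⟨h1, h2, h3⟩ := hτ _ rfl
      simp only [RegTest.holds, h2.var, h2.par, h1, lt_irrefl, not_false_eq_true]
    · intro τ hτ
      exact (hτ _ rfl).2

/-! ### Finding a string that avoids a set of position-symbol pairs -/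

/-- A labeled graph in numbers: the edges are `0, …, M - 1`, with tails `tl`, labels `lb` and heads
`hd`; strings of length `r` are read along walks from `s` to `t`. The number `P` stands for
"no edge". -/
structure Net where
  M : ℕ
  r : ℕ
  s : ℕ
  t : ℕ
  P : ℕ
  tl : ℕ → ℕ
  lb : ℕ → ℕ
  hd : ℕ → ℕ

/-- The last number below `n` that satisfies `p`, or `P` if there is none. -/
def lastBelow (P : ℕ) (p : ℕ → Prop) [DecidablePred p] : ℕ → ℕ
  | 0 => P
  | n + 1 => if p n then n else lastBelow P p n

theorem lastBelow_spec {P : ℕ} {p : ℕ → Prop} [DecidablePred p] {n : ℕ}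
    (h : lastBelow P p n < P) : lastBelow P p n < n ∧ p (lastBelow P p n) := by
  induction n with
  | zero => simp [lastBelow] at h
  | succ n ih =>
    simp only [lastBelow] at h ⊢
    split_ifs at h ⊢ with hp
    · exact ⟨by omega, hp⟩
    · exact ⟨(ih h).1.trans (by omega), (ih h).2⟩

theorem lastBelow_lt {P : ℕ} {p : ℕ → Prop} [DecidablePred p] {n e : ℕ} (he : e < n) (hp : p e)
    (hn : n ≤ P) : lastBelow P p n < P := by
  induction n with
  | zero => omega
  | succ n ih =>
    simp only [lastBelow]
    split_ifs with h
    · omega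
    · refine ih ?_ (by omega)
      rcases Nat.lt_succ_iff_lt_or_eq.1 he with h' | rfl
      · exact h'
      · exact absurd hp h

namespace Net

variable (D : Net)

/-- The first edge of a walk with `m` edges from `v` to the sink that may serve as the end of a
walk of `r` edges, or `P` if there is none. An edge `e` may not be used at a position `i` with
`ban e i ≠ 0`. For `m = 0` there is no first edge, and the value only tells whether `v` is the
sink. -/
def nx (ban : ℕ → ℕ → ℕ) : ℕ → ℕ → ℕ
  | 0, v => if v = D.t then 0 else D.P
  | m + 1, v => lastBelow D.P
      (fun e => D.tl e = v ∧ ban e (D.r - (m + 1)) < 1 ∧ nx ban m (D.hd e) < D.P) D.M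

/-- Some walk of `r` edges from the source to the sink uses no banned edge. -/
def Feasible (ban : ℕ → ℕ → ℕ) : Prop := D.nx ban D.r D.s < D.P

/-- The vertices on the walk found. -/
def vtx (ban : ℕ → ℕ → ℕ) : ℕ → ℕ
  | 0 => D.s
  | i + 1 => D.hd (D.nx ban (D.r - i) (vtx ban i))

/-- The string read along the walk found. -/
def str (ban : ℕ → ℕ → ℕ) (i : ℕ) : ℕ := D.lb (D.nx ban (D.r - i) (D.vtx ban i))

/-- Ban the symbol of the current string at position `d`. A digit `d ≥ r` bans nothing. -/
def step (ban : ℕ → ℕ → ℕ) (d : ℕ) (e i : ℕ) : ℕ :=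
  if d < D.r ∧ i = d ∧ D.lb e = D.str ban d then 1 else ban e i

/-- The bans in force after `j` digits. -/
def bans (dig : ℕ → ℕ) : ℕ → ℕ → ℕ → ℕ
  | 0 => fun _ _ => 0
  | j + 1 => D.step (bans dig j) (dig j)

/-- The string `x` is read along a walk with `m` edges from `v` to the sink, as the last `m` of its
`r` symbols. -/
def Walk : ℕ → ℕ → (ℕ → ℕ) → Prop
  | 0, v, _ => v = D.t
  | m + 1, v, x => ∃ e < D.M, D.tl e = v ∧ D.lb e = x (D.r - (m + 1)) ∧ Walk m (D.hd e) x

/-- The string `x` is in the language. -/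
def Lang (x : ℕ → ℕ) : Prop := D.Walk D.r D.s x

/-- The string `x` has none of the symbols listed in `S` at the position listed with it. -/
def Avoids (S : Finset (ℕ × ℕ)) (x : ℕ → ℕ) : Prop := ∀ i < D.r, (i, x i) ∉ S

/-- The bans that enforce avoiding `S`. -/
def banOf (S : Finset (ℕ × ℕ)) (e i : ℕ) : ℕ := if (i, D.lb e) ∈ S then 1 else 0

/-- The counterpart of `Net.step` for sets of pairs. -/
def next (S : Finset (ℕ × ℕ)) (d : ℕ) : Finset (ℕ × ℕ) :=
  if d < D.r then insert (d, D.str (D.banOf S) d) S else S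

/-- The pairs to be avoided after `j` digits, starting with `S`. -/
def avoided (S : Finset (ℕ × ℕ)) (dig : ℕ → ℕ) : ℕ → Finset (ℕ × ℕ)
  | 0 => S
  | j + 1 => D.next (avoided S dig j) (dig j)

variable {D}

theorem step_banOf (S : Finset (ℕ × ℕ)) (d : ℕ) :
    D.step (D.banOf S) d = D.banOf (D.next S d) := by
  funext e i
  unfold step next
  generalize D.str (D.banOf S) d = c
  unfold banOf
  by_cases hd : d < D.r
  · simp only [hd, true_and, if_true, Finset.mem_insert, Prod.mk.injEq]
    split_ifs <;> simp_all
  · simp [hd]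

theorem bans_eq (dig : ℕ → ℕ) (j : ℕ) : D.bans dig j = D.banOf (D.avoided ∅ dig j) := by
  induction j with
  | zero => funext e i; simp [bans, avoided, banOf]
  | succ j ih => rw [bans, ih, step_banOf, avoided]

theorem avoided_succ (S : Finset (ℕ × ℕ)) (dig : ℕ → ℕ) (j : ℕ) :
    D.avoided S dig (j + 1) = D.avoided (D.next S (dig 0)) (fun i => dig (i + 1)) j := by
  induction j with
  | zero => rfl
  | succ j ih => rw [avoided, ih]; rfl

/-- The table finds a way to the sink whenever some string that avoids `S` can be read on one. -/
theorem nx_lt {S : Finset (ℕ × ℕ)} {x : ℕ → ℕ} (hP : 0 < D.P) (hM : D.M ≤ D.P)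
    (hx : D.Avoids S x) {m v : ℕ} (hm : m ≤ D.r) (hw : D.Walk m v x) :
    D.nx (D.banOf S) m v < D.P := by
  induction m generalizing v with
  | zero => simp_all [nx, Walk]
  | succ m ih =>
    obtain ⟨e, he, h1, h2, h3⟩ := hw
    refine lastBelow_lt he ⟨h1, ?_, ih (by omega) h3⟩ hM
    simp [banOf, h2, hx (D.r - (m + 1)) (by omega)]

theorem nx_spec {ban : ℕ → ℕ → ℕ} {m v : ℕ} (h : D.nx ban (m + 1) v < D.P) :
    D.nx ban (m + 1) v < D.M ∧ D.tl (D.nx ban (m + 1) v) = v ∧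
      ban (D.nx ban (m + 1) v) (D.r - (m + 1)) < 1 ∧
      D.nx ban m (D.hd (D.nx ban (m + 1) v)) < D.P :=
  lastBelow_spec h

theorem Feasible.nx_vtx {ban : ℕ → ℕ → ℕ} (h : D.Feasible ban) {i : ℕ} (hi : i ≤ D.r) :
    D.nx ban (D.r - i) (D.vtx ban i) < D.P := by
  induction i with
  | zero => exact h
  | succ i ih =>
    have h1 := ih (by omega)
    rw [show D.r - i = (D.r - (i + 1)) + 1 by omega] at h1
    have h2 := (nx_spec h1).2.2.2
    rwa [← show D.r - i = (D.r - (i + 1)) + 1 by omega] at h2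

/-- Following the table reads the end of a string of the language, from any position on. -/
theorem Feasible.walk {ban : ℕ → ℕ → ℕ} (h : D.Feasible ban) {m : ℕ} (hm : m ≤ D.r) :
    D.Walk m (D.vtx ban (D.r - m)) (D.str ban) := by
  induction m with
  | zero =>
    have := h.nx_vtx le_rfl
    by_contra hne
    simp only [Walk, Nat.sub_zero] at hne
    simp [nx, hne] at this
  | succ m ih =>
    have h1 := h.nx_vtx (i := D.r - (m + 1)) (by omega)
    rw [show D.r - (D.r - (m + 1)) = m + 1 by omega] at h1
    obtain ⟨h2, h3, -, -⟩ := nx_spec h1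
    refine ⟨_, h2, h3, ?_, ?_⟩
    · rw [str, show D.r - (D.r - (m + 1)) = m + 1 by omega]
    · have := ih (by omega)
      rwa [show D.r - m = D.r - (m + 1) + 1 by omega, vtx,
        show D.r - (D.r - (m + 1)) = m + 1 by omega] at this

theorem Feasible.lang {ban : ℕ → ℕ → ℕ} (h : D.Feasible ban) : D.Lang (D.str ban) := by
  have := h.walk le_rfl
  rwa [Nat.sub_self] at this

theorem Feasible.avoids {S : Finset (ℕ × ℕ)} (h : D.Feasible (D.banOf S)) :
    D.Avoids S (D.str (D.banOf S)) := by
  intro i hi hS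
  have h1 := h.nx_vtx hi.le
  obtain ⟨m, hm⟩ : ∃ m, D.r - i = m + 1 := ⟨D.r - i - 1, by omega⟩
  rw [hm] at h1
  have h2 := (nx_spec h1).2.2.1
  rw [← hm, show D.r - (D.r - i) = i by omega] at h2
  unfold str at hS
  simp [banOf, hS] at h2

theorem feasible_banOf {S : Finset (ℕ × ℕ)} {x : ℕ → ℕ} (hP : 0 < D.P) (hM : D.M ≤ D.P)
    (hL : D.Lang x) (hx : D.Avoids S x) : D.Feasible (D.banOf S) :=
  nx_lt hP hM hx le_rfl hL

/-! ### Digits lead to a string avoiding any small set -/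

/-- If the language has a string `x` avoiding `Y`, then suitable digits lead to some string
avoiding `Y`: as long as the current string meets `Y`, the digit names a position where it
does, which adds a new element of `Y` to the pairs avoided; afterwards the digit `r` changes
nothing. The string `x` shows that all sets met on the way can be avoided. -/
theorem exists_digits {Y : Finset (ℕ × ℕ)} {x : ℕ → ℕ} (hP : 0 < D.P) (hM : D.M ≤ D.P)
    (hL : D.Lang x) (hx : D.Avoids Y x) (J : ℕ) (S : Finset (ℕ × ℕ)) (hS : S ⊆ Y) (hJ : 0 < J)
    (h : (Y \ S).card < J ∨ D.Avoids Y (D.str (D.banOf S))) :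
    ∃ dig : ℕ → ℕ, (∀ j, dig j ≤ D.r) ∧
      (∀ j < J, D.Feasible (D.banOf (D.avoided S dig j))) ∧
      D.Avoids Y (D.str (D.banOf (D.avoided S dig (J - 1)))) := by
  induction J generalizing S with
  | zero => omega
  | succ J ih =>
    have hf : D.Feasible (D.banOf S) :=
      feasible_banOf hP hM hL fun i hi hiS => hx i hi (hS hiS)
    suffices H : ∃ d ≤ D.r, D.next S d ⊆ Y ∧
        (J = 0 → D.Avoids Y (D.str (D.banOf S))) ∧
        (0 < J → (Y \ D.next S d).card < J ∨ D.Avoids Y (D.str (D.banOf (D.next S d)))) by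
      obtain ⟨d, hd, hdY, h0, h1⟩ := H
      rcases Nat.eq_zero_or_pos J with rfl | hJ'
      · refine ⟨fun _ => d, fun _ => hd, fun j hj => ?_, h0 rfl⟩
        obtain rfl : j = 0 := by omega
        exact hf
      · obtain ⟨dig, hr, hfe, hav⟩ := ih _ hdY hJ' (h1 hJ')
        refine ⟨fun j => Nat.casesOn j d dig, ?_, ?_, ?_⟩
        · rintro (_ | j)
          exacts [hd, hr j]
        · rintro (_ | j) hj
          · exact hf
          · rw [avoided_succ]
            exact hfe j (by omega)
        · obtain ⟨J', rfl⟩ : ∃ J', J = J' + 1 := ⟨J - 1, by omega⟩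
          rw [Nat.add_sub_cancel, avoided_succ]
          exact hav
    by_cases hav : D.Avoids Y (D.str (D.banOf S))
    · have hn : D.next S D.r = S := by simp [next]
      exact ⟨D.r, le_rfl, by rwa [hn], fun _ => hav, fun _ => Or.inr (by rwa [hn])⟩
    · have hcard := h.resolve_right hav
      simp only [Avoids, not_forall, not_not] at hav
      obtain ⟨p, hp, hpY⟩ := hav
      have hpS := hf.avoids p hp
      have hn : D.next S p = insert (p, D.str (D.banOf S) p) S := by simp [next, hp]
      have hlt : (Y \ D.next S p).card < (Y \ S).card := by
        refine Finset.card_lt_card ⟨?_, fun hsub => ?_⟩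
        · rw [hn]
          exact Finset.sdiff_subset_sdiff le_rfl (Finset.subset_insert _ _)
        · have := hsub (Finset.mem_sdiff.2 ⟨hpY, hpS⟩)
          simp [hn] at this
      refine ⟨p, hp.le, ?_, fun hJ0 => by omega, fun _ => Or.inl (by omega)⟩
      rw [hn]
      exact Finset.insert_subset hpY hS

/-! ### Exhaustive search over the digits finds diverse strings -/

/-- The Hamming distance of two strings of length `r`. -/
def dist (r : ℕ) (x y : ℕ → ℕ) : ℕ := ((Finset.range r).filter fun i => x i ≠ y i).card

theorem dist_comm (r : ℕ) (x y : ℕ → ℕ) : dist r x y = dist r y x := by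
  simp [dist, ne_comm]

variable (D)

/-- The number of digits for one string, in a search for `K` strings: one more than the number of
symbols that the string may have to avoid. -/
def rounds (K : ℕ) : ℕ := D.r * K + 1

/-- The digits for the `k`-th string: a block of the digits of `z` to the base `r + 1`. -/
def digit (K z k j : ℕ) : ℕ := z / (D.r + 1) ^ (k * D.rounds K + j) % (D.r + 1)

/-- The `k`-th string obtained from the digits of `z`. -/
def out (K z k : ℕ) : ℕ → ℕ := D.str (D.bans (D.digit K z k) (D.rounds K - 1))

/-- The number `z` leads to `K` strings of the language with pairwise distance at least `Δ`. -/
def Accepts (K Δ z : ℕ) : Prop :=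
  (∀ k < K, ∀ j < D.rounds K, D.Feasible (D.bans (D.digit K z k) j)) ∧
    ∀ k < K, ∀ l < K, l < k → Δ ≤ dist D.r (D.out K z k) (D.out K z l)

variable {D}

/-- Every sequence of digits belongs to some number. -/
theorem exists_number (b : ℕ) (δ : ℕ → ℕ) (hδ : ∀ j, δ j ≤ b) (n : ℕ) :
    ∃ z < (b + 1) ^ n, ∀ j < n, z / (b + 1) ^ j % (b + 1) = δ j := by
  induction n generalizing δ with
  | zero => exact ⟨0, by simp, by simp⟩
  | succ n ih =>
    obtain ⟨z, hz, h⟩ := ih (fun j => δ (j + 1)) fun j => hδ _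
    refine ⟨δ 0 + (b + 1) * z, ?_, ?_⟩
    · rw [pow_succ']
      have h1 := hδ 0
      have h2 := Nat.mul_le_mul_left (b + 1) (Nat.succ_le_of_lt hz)
      rw [Nat.mul_succ] at h2
      omega
    · rintro (_ | j) hj
      · simp [Nat.mod_eq_of_lt (Nat.lt_succ_of_le (hδ 0))]
      · rw [pow_succ', ← Nat.div_div_eq_div_mul, Nat.add_mul_div_left _ _ (Nat.succ_pos b),
          Nat.div_eq_of_lt (Nat.lt_succ_of_le (hδ 0)), zero_add]
        exact h j (by omega)

theorem bans_congr {dig dig' : ℕ → ℕ} {j : ℕ} (h : ∀ i < j, dig i = dig' i) :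
    D.bans dig j = D.bans dig' j := by
  induction j with
  | zero => rfl
  | succ j ih => rw [bans, bans, ih fun i hi => h i (by omega), h j (by omega)]

/-- One string of a solution may be replaced by any string of the language that avoids the symbols
in which the others differ from it. -/
theorem exists_digits_replacing (hP : 0 < D.P) (hM : D.M ≤ D.P) {K Δ : ℕ} {X : ℕ → ℕ → ℕ}
    (hX : ∀ k < K, D.Lang (X k)) (hd : ∀ k < K, ∀ l < K, l ≠ k → Δ ≤ dist D.r (X k) (X l))
    {k : ℕ} (hk : k < K) :
    ∃ dig : ℕ → ℕ, (∀ j, dig j ≤ D.r) ∧ (∀ j < D.rounds K, D.Feasible (D.bans dig j)) ∧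
      ∀ l < K, l ≠ k → Δ ≤ dist D.r (D.str (D.bans dig (D.rounds K - 1))) (X l) := by
  -- A string avoiding `Y` differs from each of the others wherever the `k`-th string does.
  set Y : Finset (ℕ × ℕ) := ((Finset.range D.r ×ˢ Finset.range K).filter
    fun p => X p.2 p.1 ≠ X k p.1).image fun p => (p.1, X p.2 p.1) with hY
  have hav : D.Avoids Y (X k) := by
    intro i _ hi
    simp only [hY, Finset.mem_image, Finset.mem_filter, Prod.mk.injEq] at hi
    obtain ⟨p, ⟨-, h1⟩, rfl, h2⟩ := hi
    exact h1 h2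
  have hcard : (Y \ ∅).card < D.rounds K := by
    rw [Finset.sdiff_empty, rounds, Nat.lt_succ_iff]
    refine Finset.card_image_le.trans ((Finset.card_filter_le _ _).trans ?_)
    simp
  obtain ⟨dig, h1, h2, h3⟩ := exists_digits hP hM (hX k hk) hav (D.rounds K) ∅
    (Finset.empty_subset _) (by simp [rounds]) (Or.inl hcard)
  simp only [← bans_eq] at h2 h3
  refine ⟨dig, h1, h2, fun l hl hlk => (hd k hk l hl hlk).trans (Finset.card_le_card ?_)⟩
  intro i hi
  simp only [Finset.mem_filter, Finset.mem_range] at hi ⊢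
  refine ⟨hi.1, fun h => h3 i hi.1 ?_⟩
  simp only [hY, Finset.mem_image, Finset.mem_filter, Finset.mem_product, Finset.mem_range,
    Prod.mk.injEq]
  exact ⟨(i, l), ⟨⟨hi.1, hl⟩, Ne.symm hi.2⟩, rfl, h.symm⟩

/-- The search succeeds exactly when there are `K` strings with pairwise distance at
least `Δ`. -/
theorem exists_accepts_iff (hP : 0 < D.P) (hM : D.M ≤ D.P) (K Δ : ℕ) :
    (∃ z < (D.r + 1) ^ (K * D.rounds K), D.Accepts K Δ z) ↔
      ∃ X : ℕ → ℕ → ℕ, (∀ k < K, D.Lang (X k)) ∧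
        ∀ k < K, ∀ l < K, l < k → Δ ≤ dist D.r (X k) (X l) := by
  have hq : 0 < D.rounds K := by simp [rounds]
  constructor
  · rintro ⟨z, -, h1, h2⟩
    exact ⟨D.out K z, fun k hk => (h1 k hk _ (Nat.sub_lt hq one_pos)).lang, h2⟩
  · rintro ⟨X, hX, hd⟩
    -- The strings of the solution are replaced one after the other.
    have key : ∀ n ≤ K, ∃ (X : ℕ → ℕ → ℕ) (dig : ℕ → ℕ → ℕ), (∀ k < K, D.Lang (X k)) ∧
        (∀ k < K, ∀ l < K, l ≠ k → Δ ≤ dist D.r (X k) (X l)) ∧ (∀ k j, dig k j ≤ D.r) ∧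
        ∀ k < n, (∀ j < D.rounds K, D.Feasible (D.bans (dig k) j)) ∧
          X k = D.str (D.bans (dig k) (D.rounds K - 1)) := by
      intro n
      induction n with
      | zero =>
        refine fun _ => ⟨X, fun _ _ => 0, hX, fun k hk l hl hlk => ?_, by simp, by simp⟩
        rcases Nat.lt_or_gt_of_ne hlk with h | h
        · exact hd k hk l hl h
        · rw [dist_comm]
          exact hd l hl k hk h
      | succ n ih =>
        intro hn
        obtain ⟨X, dig, hX, hd, hr, hdig⟩ := ih (by omega)
        obtain ⟨δ, h1, h2, h3⟩ := exists_digits_replacing hP hM hX hd (k := n) (by omega)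
        have hfe := h2 _ (Nat.sub_lt hq one_pos)
        refine ⟨Function.update X n (D.str (D.bans δ (D.rounds K - 1))),
          Function.update dig n δ, fun k hk => ?_, fun k hk l hl hlk => ?_, fun k j => ?_,
          fun k hk => ?_⟩
        · rcases eq_or_ne k n with rfl | h
          · simpa using hfe.lang
          · simpa [h] using hX k hk
        · rcases eq_or_ne k n with rfl | h
          · simpa [hlk] using h3 l hl hlk
          · rcases eq_or_ne l n with rfl | h'
            · rw [dist_comm]
              simpa [h] using h3 k hk h
            · simpa [h, h'] using hd k hk l hl hlk
        · rcases eq_or_ne k n with rfl | h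
          · simpa using h1 j
          · simpa [h] using hr k j
        · rcases eq_or_ne k n with rfl | h
          · simpa using h2
          · simpa [h] using hdig k (by omega)
    obtain ⟨X, dig, hX, hd, hr, hdig⟩ := key K le_rfl
    obtain ⟨z, hz, hzd⟩ := exists_number D.r (fun m => dig (m / D.rounds K) (m % D.rounds K))
      (fun _ => hr _ _) (K * D.rounds K)
    have hdz : ∀ k < K, ∀ j < D.rounds K, D.digit K z k j = dig k j := by
      intro k hk j hj
      have h1 : k * D.rounds K + j < K * D.rounds K := by
        have := Nat.mul_le_mul_right (D.rounds K) (Nat.succ_le_of_lt hk)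
        rw [Nat.succ_mul] at this
        omega
      rw [digit, hzd _ h1, Nat.mul_comm k, Nat.mul_add_div hq, Nat.mul_add_mod,
        Nat.div_eq_of_lt hj, Nat.mod_eq_of_lt hj, add_zero]
    have hb : ∀ k < K, ∀ j < D.rounds K, D.bans (D.digit K z k) j = D.bans (dig k) j :=
      fun k hk j hj => bans_congr fun i hi => hdz k hk i (hi.trans hj)
    have hout : ∀ k < K, D.out K z k = X k := fun k hk => by
      rw [out, hb k hk _ (Nat.sub_lt hq one_pos), (hdig k hk).2]
    refine ⟨z, hz, fun k hk j hj => ?_, fun k hk l hl hlk => ?_⟩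
    · rw [hb k hk j hj]
      exact (hdig k hk).1 j hj
    · rw [hout k hk, hout l hl]
      exact hd k hk l hl hlk.ne

end Net

/-! ### The search as a program -/

namespace Ex

def sub (a b : Ex) : Ex := .op .sub (fun a b => Nat.sub_le a b) a b
def div (a b : Ex) : Ex := .op .div (fun a b => Nat.div_le_self a b) a b
def mod (a b : Ex) : Ex := .op .mod (fun a b => Nat.mod_le a b) a b

def tl (e : Ex) : Ex := .inp 0 e
def lb (e : Ex) : Ex := .inp 1 e
def hd (e : Ex) : Ex := .inp 2 e

end Ex

namespace Cmd

open Ex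

/-- Remove all bans. -/
def clearBan : Cmd := .count .e .M <| .count .i .r <| put .ban (var .e) (var .i) (lit 0)

/-- Fill the table `nx` with the value for "no edge". -/
def clearNx : Cmd := .count .v .P <| .count .i .stride <| put .nx (var .v) (var .i) (par .P)

/-- Compute row `i + 1` of the table from row `i`. -/
def fillRow : Cmd :=
  seq (set .c (sub (sub (par .r) (lit 1)) (var .i))) <|
  .count .e .M <|
    ite .lt (get .ban (var .e) (var .c)) (lit 1)
      (ite .lt (get .nx (hd (var .e)) (var .i)) (par .P)
        (put .nx (tl (var .e)) (sub (par .r) (var .c)) (var .e)) skip) skip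

/-- Compute the table `Net.nx`. -/
def fillNx : Cmd :=
  seq clearNx <| seq (put .nx (par .t) (lit 0) (lit 0)) <| .count .i .r fillRow

/-- Follow the table from the source to the sink, and store the string read. -/
def readStr : Cmd :=
  seq (set .v (par .s)) <|
  .count .i .r <|
    seq (set .c (get .nx (var .v) (sub (par .r) (var .i)))) <|
    seq (put .str (var .k) (var .i) (lb (var .c))) <|
    set .v (hd (var .c))

/-- Split a digit off `y`, and ban the symbol of the current string at that position. -/
def useDigit : Cmd :=
  seq (set .d (mod (var .y) (par .stride))) <|
  seq (set .y (div (var .y) (par .stride))) <|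
  ite .lt (var .d) (par .r)
    (seq (set .a (get .str (var .k) (var .d))) <|
      .count .e .M <|
        ite .eq (lb (var .e)) (var .a) (put .ban (var .e) (var .d) (lit 1)) skip) skip

/-- Find a string that respects the bans, and use one more digit. -/
def round : Cmd :=
  seq fillNx <| seq (ite .lt (get .nx (par .s) (par .r)) (par .P) skip (set .ok (lit 0))) <|
  seq readStr useDigit

/-- Construct the string number `k`. -/
def buildStr : Cmd := seq clearBan (.count .j .q round)

/-- Check that the strings number `k` and `l` have distance at least `Δ`, counting down from
`Δ`. -/
def checkPair : Cmd :=
  seq (set .h (par .Δ)) <|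
  seq (.count .i .r <|
    ite .eq (get .str (var .k) (var .i)) (get .str (var .l) (var .i)) skip
      (set .h (sub (var .h) (lit 1)))) <|
  ite .eq (var .h) (lit 0) skip (set .ok (lit 0))

/-- Check the distances of all pairs of strings. -/
def check : Cmd := .count .k .K <| .count .l .K <| ite .lt (var .l) (var .k) checkPair skip

/-- Construct and check the strings given by the digits of `z`. -/
def tryNumber : Cmd :=
  seq (set .y (var .z)) <| seq (set .ok (lit 1)) <| seq (.count .k .K buildStr) <| seq check <|
  ite .eq (var .ok) (lit 1) (set .ans (lit 1)) skip

/-- Try all numbers below `N`. -/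
def search : Cmd := seq (set .ans (lit 0)) (.count .z .N tryNumber)

end Cmd

/-! ### Correctness of the program -/

/-- The graph in the input. -/
def Env.net (E : Env) : Net where
  M := E.par .M
  r := E.par .r
  s := E.par .s
  t := E.par .t
  P := E.par .P
  tl := E.word 0
  lb := E.word 1
  hd := E.word 2

/-- All indices the program uses are in the range of the arrays. -/
structure Env.InRange (E : Env) : Prop where
  stride : E.par .stride = E.par .r + 1
  posP : 0 < E.par .P
  M : E.par .M ≤ E.par .P
  K : E.par .K ≤ E.par .P
  s : E.par .s < E.par .P
  t : E.par .t < E.par .P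
  /-- tails and heads are vertices, also for numbers that do not belong to an edge -/
  word : ∀ c e, c ≠ 1 → E.word c e < E.par .P

variable {E : Env}

-- Proofs by `rfl` of facts about `Cmd.writes` or `Cmd.puts` below say that a program does not
-- touch the variable or array at hand.

theorem eval_clearBan (hE : E.InRange) (ρ : HState) {e i : ℕ} (he : e < E.par .M)
    (hi : i < E.par .r) : (Cmd.clearBan.eval E ρ).a .ban e i = 0 := by
  have hM := hE.M
  have hst := hE.stride
  refine Cmd.eval_count (E := E) (fun n ρ' => ∀ e < n, ∀ i < E.par .r, ρ'.a .ban e i = 0)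
    (by simp) ?_ e he i hi
  intro n ρ₁ hn hv _ hI
  have := Cmd.eval_count (E := E) (x := .i) (b := .r)
    (p := .put .ban (.var .e) (.var .i) (.lit 0)) (ρ := ρ₁)
    (fun m ρ' => ∀ e i, i < E.par .r → (e < n ∨ e = n ∧ i < m) → ρ'.a .ban e i = 0)
    (by
      intro e i hi h
      exact hI e (by omega) i hi)
    (by
      intro m ρ₂ hm hvi hfr hI' e i hi h
      have hve : ρ₂.v .e = n := by rw [hfr .e rfl, hv]
      simp only [Cmd.eval, Ex.val, HState.set_a, HState.put_a, hvi, hve,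
        Nat.mod_eq_of_lt (show n < E.par .P by omega),
        Nat.mod_eq_of_lt (show m < E.par .stride by omega)]
      split_ifs with hc
      · rfl
      · refine hI' e i hi ?_
        simp only [true_and, not_and] at hc
        omega)
  intro e he i hi
  exact this e i hi (by omega)

theorem eval_clearNx (ρ : HState) {v i : ℕ} (hv : v < E.par .P) (hi : i < E.par .stride) :
    (Cmd.clearNx.eval E ρ).a .nx v i = E.par .P := by
  refine Cmd.eval_count (E := E)
    (fun n ρ' => ∀ e < n, ∀ i < E.par .stride, ρ'.a .nx e i = E.par .P) (by simp) ?_ v hv i hi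
  intro n ρ₁ hn hv _ hI
  have := Cmd.eval_count (E := E) (x := .i) (b := .stride)
    (p := .put .nx (.var .v) (.var .i) (.par .P)) (ρ := ρ₁)
    (fun m ρ' => ∀ e i, i < E.par .stride → (e < n ∨ e = n ∧ i < m) → ρ'.a .nx e i = E.par .P)
    (by
      intro e i hi h
      exact hI e (by omega) i hi)
    (by
      intro m ρ₂ hm hvi hfr hI' e i hi h
      have hve : ρ₂.v .v = n := by rw [hfr .v rfl, hv]
      simp only [Cmd.eval, Ex.val, HState.set_a, HState.put_a, hvi, hve,
        Nat.mod_eq_of_lt (show n < E.par .P by omega),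
        Nat.mod_eq_of_lt (show m < E.par .stride by omega)]
      split_ifs with hc
      · rfl
      · refine hI' e i hi ?_
        simp only [true_and, not_and] at hc
        omega)
  intro e he i hi
  exact this e i hi (by omega)

/-- The array `ban` holds the bans `B`. -/
def BanRep (E : Env) (ρ : HState) (B : ℕ → ℕ → ℕ) : Prop :=
  ∀ e < E.par .M, ∀ i < E.par .r, ρ.a .ban e i = B e i

/-- The rows up to `n` of the table are filled, and the others are cleared. -/
def NxRep (E : Env) (B : ℕ → ℕ → ℕ) (n : ℕ) (ρ : HState) : Prop :=
  ∀ v < E.par .P, ∀ m ≤ E.par .r,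
    ρ.a .nx v m = if m ≤ n then E.net.nx B m v else E.par .P

theorem eval_fillRow (hE : E.InRange) {ρ : HState} {B : ℕ → ℕ → ℕ} (hB : BanRep E ρ B) {n : ℕ}
    (hn : n < E.par .r) (hi : ρ.v .i = n) (hI : NxRep E B n ρ) :
    NxRep E B (n + 1) (Cmd.fillRow.eval E ρ) := by
  have hM := hE.M
  have hst := hE.stride
  rw [Cmd.fillRow, Cmd.eval]
  set ρ₁ := Cmd.eval E (.set .c _) ρ with hρ₁
  have hc : ρ₁.v .c = E.par .r - 1 - n := by
    simp [hρ₁, Cmd.eval, Ex.val, Ex.sub, ArithOp.eval, hi]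
  have hi₁ : ρ₁.v .i = n := by simp [hρ₁, Cmd.eval, hi]
  have ha₁ : ρ₁.a = ρ.a := rfl
  have key := Cmd.eval_count (E := E) (x := .e) (b := .M)
    (p := .ite .lt (.get .ban (.var .e) (.var .c)) (.lit 1)
      (.ite .lt (.get .nx (.hd (.var .e)) (.var .i)) (.par .P)
        (.put .nx (.tl (.var .e)) (.sub (.par .r) (.var .c)) (.var .e)) .skip) .skip) (ρ := ρ₁)
    (fun l ρ' => ρ'.a .ban = ρ.a .ban ∧ ∀ v < E.par .P, ∀ m ≤ E.par .r, ρ'.a .nx v m =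
      if m ≤ n then E.net.nx B m v else if m = n + 1 then
        lastBelow (E.par .P) (fun e => E.word 0 e = v ∧ B e (E.par .r - (n + 1)) < 1 ∧
          E.net.nx B n (E.word 2 e) < E.par .P) l
      else E.par .P)
    (by
      refine ⟨by rw [HState.set_a, ha₁], fun v hv m hm => ?_⟩
      rw [HState.set_a, ha₁, hI v hv m hm]
      simp [lastBelow])
    (by
      rintro l ρ₂ hl he hfr ⟨hban, hnx⟩
      have h1 : ρ₂.v .c = E.par .r - (n + 1) := by rw [hfr .c rfl, hc]; omega
      have h2 : ρ₂.v .i = n := by rw [hfr .i rfl, hi₁]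
      have h3 := hB l hl (E.par .r - (n + 1)) (by omega)
      have h4 := hE.word 2 l (by decide)
      have h5 := hE.word 0 l (by decide)
      have h6 := hnx (E.word 2 l) h4 n (by omega)
      rw [if_pos le_rfl] at h6
      simp only [Cmd.eval, Ex.val, Ex.hd, Ex.tl, Ex.sub, ArithOp.eval, h1, h2, he, Cmp.holds,
        Nat.mod_eq_of_lt (show l < E.par .P by omega), Nat.mod_eq_of_lt h4, Nat.mod_eq_of_lt h5,
        Nat.mod_eq_of_lt (show n < E.par .stride by omega),
        Nat.mod_eq_of_lt (show E.par .r - (n + 1) < E.par .stride by omega),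
        Nat.mod_eq_of_lt (show n + 1 < E.par .stride by omega),
        show E.par .r - (E.par .r - (n + 1)) = n + 1 by omega, hban, h3, h6]
      simp only [Fin.val_one, HState.set_a]
      by_cases hb : B l (E.par .r - (n + 1)) < 1
      · by_cases hn' : E.net.nx B n (E.word 2 l) < E.par .P
        · simp only [if_pos hb, if_pos hn']
          refine ⟨by funext i j; simp [hban], fun v hv m hm => ?_⟩
          rw [HState.put_a, hnx v hv m hm]
          simp only [lastBelow, hb, hn', and_true, true_and]
          by_cases hm1 : m = n + 1
          · subst hm1
            by_cases hv' : E.word 0 l = v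
            · simp [hv']
            · simp [hv', Ne.symm hv']
          · simp [hm1]
        · simp only [if_pos hb, if_neg hn']
          refine ⟨hban, fun v hv m hm => ?_⟩
          rw [hnx v hv m hm]
          simp [lastBelow, hn']
      · simp only [if_neg hb]
        refine ⟨hban, fun v hv m hm => ?_⟩
        rw [hnx v hv m hm]
        simp [lastBelow, hb])
  intro v hv m hm
  rw [key.2 v hv m hm]
  by_cases h1 : m ≤ n
  · simp [h1, show m ≤ n + 1 by omega]
  · by_cases h2 : m = n + 1
    · subst h2
      simp only [if_neg h1, le_rfl, if_true, Net.nx]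
      rfl
    · simp [h1, h2, show ¬ m ≤ n + 1 by omega]

theorem eval_fillNx (hE : E.InRange) {ρ : HState} {B : ℕ → ℕ → ℕ} (hB : BanRep E ρ B) :
    NxRep E B (E.par .r) (Cmd.fillNx.eval E ρ) := by
  have hst := hE.stride
  rw [Cmd.fillNx, Cmd.eval, Cmd.eval]
  refine (Cmd.eval_count (E := E) (fun n ρ' => BanRep E ρ' B ∧ NxRep E B n ρ') ⟨?_, ?_⟩ ?_).2
  · intro e he i hi
    rw [HState.set_a, Cmd.eval_a _ _ _ rfl, Cmd.eval_a _ _ _ rfl, hB e he i hi]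
  · intro v hv m hm
    simp only [HState.set_a, Cmd.eval, Ex.val, HState.put_a, Nat.mod_eq_of_lt hE.t, Fin.val_zero,
      Nat.zero_mod]
    rw [eval_clearNx _ hv (by omega)]
    by_cases h : m = 0
    · subst h
      simp [Net.nx, Env.net]
      rfl
    · simp [h]
  · rintro n ρ₁ hn hi - ⟨h1, h2⟩
    refine ⟨?_, eval_fillRow hE h1 hn hi h2⟩
    intro e he i hi
    rw [HState.set_a, Cmd.eval_a _ _ _ rfl, h1 e he i hi]

/-- Vertices and edges outside the graph do not matter here, as `Net.vtx` is defined by the same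
table look-ups even if no walk exists. -/
theorem eval_readStr (hE : E.InRange) {ρ : HState} {B : ℕ → ℕ → ℕ}
    (hnx : NxRep E B (E.par .r) ρ) (hk : ρ.v .k < E.par .K) :
    (∀ i < E.par .r, (Cmd.readStr.eval E ρ).a .str (ρ.v .k) i = E.net.str B i) ∧
      ∀ k ≠ ρ.v .k, (Cmd.readStr.eval E ρ).a .str k = ρ.a .str k := by
  have hst := hE.stride
  have hK := hE.K
  rw [Cmd.readStr, Cmd.eval]
  set ρ₁ := Cmd.eval E (.set .v _) ρ with hρ₁
  have hv₁ : ρ₁.v .v = E.par .s := by simp [hρ₁, Cmd.eval, Ex.val]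
  have hk₁ : ρ₁.v .k = ρ.v .k := by simp [hρ₁, Cmd.eval]
  have ha₁ : ρ₁.a = ρ.a := rfl
  have key := Cmd.eval_count (E := E) (x := .i) (b := .r)
    (p := .seq (.set .c (.get .nx (.var .v) (.sub (.par .r) (.var .i)))) <|
      .seq (.put .str (.var .k) (.var .i) (.lb (.var .c))) <|
      .set .v (.hd (.var .c))) (ρ := ρ₁)
    (fun n ρ' => ρ'.a .nx = ρ.a .nx ∧ ρ'.v .v = E.net.vtx B n ∧
      (∀ i < n, ρ'.a .str (ρ.v .k) i = E.net.str B i) ∧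
      ∀ k ≠ ρ.v .k, ρ'.a .str k = ρ.a .str k)
    (by
      refine ⟨by rw [HState.set_a, ha₁], by simp [hv₁, Net.vtx, Env.net], by simp, fun k _ => by
        rw [HState.set_a, ha₁]⟩)
    (by
      rintro n ρ₂ hn hi hfr ⟨h1, h2, h3, h4⟩
      have hk₂ : ρ₂.v .k = ρ.v .k := by rw [hfr .k rfl, hk₁]
      -- The vertex reached is a valid index, also if no walk exists.
      have hvP : E.net.vtx B n < E.par .P := by
        cases n with
        | zero => exact hE.s
        | succ n => exact hE.word 2 _ (by decide)
      have h5 := hnx _ hvP (E.par .r - n) (by omega)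
      rw [if_pos (by omega)] at h5
      simp only [Cmd.eval, Ex.val, Ex.hd, Ex.lb, Ex.sub, ArithOp.eval, HState.set_a, HState.put_a,
        HState.set_v, HState.put_v, reduceCtorEq, if_false, if_true, hi, h2, h1, hk₂,
        Nat.mod_eq_of_lt hvP, Nat.mod_eq_of_lt (show ρ.v .k < E.par .P by omega),
        Nat.mod_eq_of_lt (show n < E.par .stride by omega),
        Nat.mod_eq_of_lt (show E.par .r - n < E.par .stride by omega), h5]
      refine ⟨by funext i j; simp [h1], rfl, fun i hi => ?_, fun k hk => ?_⟩
      · by_cases h : i = n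
        · subst h
          simp only [and_self, if_true]
          rfl
        · simp [h, h3 i (by omega)]
      · funext i
        simp [hk, h4 k hk])
  exact ⟨key.2.2.1, key.2.2.2⟩

theorem eval_useDigit (hE : E.InRange) {ρ : HState} {B : ℕ → ℕ → ℕ} (hB : BanRep E ρ B)
    (hk : ρ.v .k < E.par .K) (hs : ∀ i < E.par .r, ρ.a .str (ρ.v .k) i = E.net.str B i) :
    BanRep E (Cmd.useDigit.eval E ρ) (E.net.step B (ρ.v .y % (E.par .r + 1))) ∧
      (Cmd.useDigit.eval E ρ).v .y = ρ.v .y / (E.par .r + 1) := by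
  have hst := hE.stride
  have hK := hE.K
  have hM := hE.M
  simp only [Cmd.useDigit, Cmd.eval_seq]
  set ρ₁ := Cmd.eval E (.set .d _) ρ with hρ₁
  set ρ₂ := Cmd.eval E (.set .y _) ρ₁ with hρ₂
  generalize hd : ρ.v .y % (E.par .r + 1) = d
  have hd₂ : ρ₂.v .d = d := by
    simp [hρ₂, hρ₁, Cmd.eval, Ex.val, Ex.mod, ArithOp.eval, hst, hd]
  have hy₂ : ρ₂.v .y = ρ.v .y / (E.par .r + 1) := by
    simp [hρ₂, hρ₁, Cmd.eval, Ex.val, Ex.div, ArithOp.eval, hst]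
  have hk₂ : ρ₂.v .k = ρ.v .k := by simp [hρ₂, hρ₁, Cmd.eval]
  have ha₂ : ρ₂.a = ρ.a := rfl
  refine ⟨?_, by rw [Cmd.eval_v _ _ _ rfl, hy₂]⟩
  rw [Cmd.eval_ite]
  simp only [Ex.val, hd₂, Cmp.holds]
  by_cases hdr : d < E.par .r
  · rw [if_pos hdr, Cmd.eval_seq]
    set ρ₃ := Cmd.eval E (.set .a _) ρ₂ with hρ₃
    have hA : ρ₃.v .a = E.net.str B d := by
      simp [hρ₃, Cmd.eval, Ex.val, hk₂, hd₂, ha₂,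
        Nat.mod_eq_of_lt (show ρ.v .k < E.par .P by omega),
        Nat.mod_eq_of_lt (show d < E.par .stride by omega), hs d hdr]
    have hd₃ : ρ₃.v .d = d := by simp [hρ₃, Cmd.eval, hd₂]
    have key := Cmd.eval_count (E := E) (x := .e) (b := .M)
      (p := .ite .eq (.lb (.var .e)) (.var .a) (.put .ban (.var .e) (.var .d) (.lit 1)) .skip)
      (ρ := ρ₃)
      (fun n ρ' => ∀ e < E.par .M, ∀ i < E.par .r, ρ'.a .ban e i =
        if e < n then E.net.step B d e i else B e i)
      (by
        intro e he i hi
        simpa [show ρ₃.a = ρ.a from rfl] using hB e he i hi)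
      (by
        intro n ρ₄ hn he hfr hI e' he' i hi
        have hA₄ : ρ₄.v .a = E.net.str B d := by rw [hfr .a rfl, hA]
        have hd₄ : ρ₄.v .d = d := by rw [hfr .d rfl, hd₃]
        simp only [Cmd.eval, Ex.val, Ex.lb, Cmp.holds, he, hA₄, hd₄,
          Nat.mod_eq_of_lt (show n < E.par .P by omega),
          Nat.mod_eq_of_lt (show d < E.par .stride by omega), HState.set_a]
        have hstep : E.net.step B d e' i =
            if i = d ∧ E.word 1 e' = E.net.str B d then 1 else B e' i := by
          show (if d < E.par .r ∧ i = d ∧ E.word 1 e' = E.net.str B d then 1 else B e' i) = _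
          simp [hdr]
        by_cases hw : E.word 1 n = E.net.str B d
        · rw [if_pos hw, HState.put_a, hI e' he' i hi]
          rcases lt_trichotomy e' n with h | rfl | h
          · simp [h, h.ne, show e' < n + 1 by omega]
          · simp [hstep, hw]
          · simp [h.ne', show ¬ e' < n by omega, show ¬ e' < n + 1 by omega]
        · rw [if_neg hw, hI e' he' i hi]
          rcases lt_trichotomy e' n with h | rfl | h
          · simp [h, show e' < n + 1 by omega]
          · simp [hstep, hw]
          · simp [show ¬ e' < n by omega, show ¬ e' < n + 1 by omega])
    intro e he i hi
    rw [key e he i hi, if_pos he]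
  · rw [if_neg hdr, Cmd.eval]
    intro e he i hi
    rw [ha₂, hB e he i hi]
    simp [Net.step, Env.net, hdr]

/-- One round replaces the string number `k` by the one that respects the bans, records whether
there is one, and bans the symbol at the position given by the next digit. -/
theorem eval_round (hE : E.InRange) {ρ : HState} {B : ℕ → ℕ → ℕ} (hB : BanRep E ρ B)
    (hk : ρ.v .k < E.par .K) :
    BanRep E (Cmd.round.eval E ρ) (E.net.step B (ρ.v .y % (E.par .r + 1))) ∧
      (Cmd.round.eval E ρ).v .y = ρ.v .y / (E.par .r + 1) ∧
      ((Cmd.round.eval E ρ).v .ok = 1 ↔ ρ.v .ok = 1 ∧ E.net.Feasible B) ∧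
      (∀ i < E.par .r, (Cmd.round.eval E ρ).a .str (ρ.v .k) i = E.net.str B i) ∧
      ∀ k ≠ ρ.v .k, (Cmd.round.eval E ρ).a .str k = ρ.a .str k := by
  have hst := hE.stride
  simp only [Cmd.round, Cmd.eval_seq]
  have hnx := eval_fillNx hE hB
  set ρ₁ := Cmd.fillNx.eval E ρ with hρ₁
  have hk₁ : ρ₁.v .k = ρ.v .k := Cmd.eval_v _ _ _ rfl
  have hy₁ : ρ₁.v .y = ρ.v .y := Cmd.eval_v _ _ _ rfl
  have hok₁ : ρ₁.v .ok = ρ.v .ok := Cmd.eval_v _ _ _ rfl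
  have hban₁ : ρ₁.a .ban = ρ.a .ban := Cmd.eval_a _ _ _ rfl
  have hstr₁ : ρ₁.a .str = ρ.a .str := Cmd.eval_a _ _ _ rfl
  set ρ₂ := Cmd.eval E (.ite .lt _ _ _ _) ρ₁ with hρ₂
  have ha₂ : ∀ u, ρ₂.a u = ρ₁.a u := fun u => Cmd.eval_a _ _ _ rfl
  have hk₂ : ρ₂.v .k = ρ.v .k := by rw [← hk₁]; exact Cmd.eval_v _ _ _ rfl
  have hy₂ : ρ₂.v .y = ρ.v .y := by rw [← hy₁]; exact Cmd.eval_v _ _ _ rfl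
  have hok₂ : ρ₂.v .ok = 1 ↔ ρ.v .ok = 1 ∧ E.net.Feasible B := by
    have h := hnx _ hE.s (E.par .r) le_rfl
    rw [if_pos le_rfl] at h
    simp only [hρ₂, Cmd.eval, Ex.val, Cmp.holds, Nat.mod_eq_of_lt hE.s,
      Nat.mod_eq_of_lt (show E.par .r < E.par .stride by omega), h]
    by_cases hf : E.net.nx B (E.par .r) (E.par .s) < E.par .P
    · rw [if_pos hf, hok₁]
      exact ⟨fun h => ⟨h, hf⟩, fun h => h.1⟩
    · rw [if_neg hf]
      simp only [HState.set_v, if_true, Fin.val_zero, zero_ne_one, false_iff]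
      exact fun h => hf h.2
  have hnx₂ : NxRep E B (E.par .r) ρ₂ := fun v hv m hm => by rw [ha₂, hnx v hv m hm]
  obtain ⟨h1, h2⟩ := eval_readStr hE hnx₂ (hk₂.symm ▸ hk)
  set ρ₃ := Cmd.readStr.eval E ρ₂ with hρ₃
  have hk₃ : ρ₃.v .k = ρ.v .k := by rw [← hk₂]; exact Cmd.eval_v _ _ _ rfl
  have hy₃ : ρ₃.v .y = ρ.v .y := by rw [← hy₂]; exact Cmd.eval_v _ _ _ rfl
  have hB₃ : BanRep E ρ₃ B := by
    intro e he i hi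
    rw [Cmd.eval_a _ _ _ rfl, ha₂, hban₁, hB e he i hi]
  rw [hk₂] at h1 h2
  obtain ⟨h3, h4⟩ := eval_useDigit hE hB₃ (hk₃.symm ▸ hk) (hk₃.symm ▸ h1)
  rw [hy₃] at h3 h4
  refine ⟨h3, h4, ?_, fun i hi => ?_, fun k hk => ?_⟩
  · rw [Cmd.eval_v _ _ _ rfl, ← hok₂, hρ₃, Cmd.eval_v _ _ _ rfl]
  · rw [Cmd.eval_a _ _ _ rfl, h1 i hi]
  · rw [Cmd.eval_a _ _ _ rfl, h2 k hk, ha₂, hstr₁]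

theorem eval_buildStr (hE : E.InRange) (hq : 0 < E.par .q) {ρ : HState}
    (hk : ρ.v .k < E.par .K) {dig : ℕ → ℕ}
    (hdig : ∀ j, dig j = ρ.v .y / (E.par .r + 1) ^ j % (E.par .r + 1)) :
    (Cmd.buildStr.eval E ρ).v .y = ρ.v .y / (E.par .r + 1) ^ E.par .q ∧
      ((Cmd.buildStr.eval E ρ).v .ok = 1 ↔
        ρ.v .ok = 1 ∧ ∀ j < E.par .q, E.net.Feasible (E.net.bans dig j)) ∧
      (∀ i < E.par .r, (Cmd.buildStr.eval E ρ).a .str (ρ.v .k) i =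
        E.net.str (E.net.bans dig (E.par .q - 1)) i) ∧
      ∀ k ≠ ρ.v .k, (Cmd.buildStr.eval E ρ).a .str k = ρ.a .str k := by
  rw [Cmd.buildStr, Cmd.eval]
  set ρ₁ := Cmd.clearBan.eval E ρ with hρ₁
  have hk₁ : ρ₁.v .k = ρ.v .k := Cmd.eval_v _ _ _ rfl
  have hy₁ : ρ₁.v .y = ρ.v .y := Cmd.eval_v _ _ _ rfl
  have hok₁ : ρ₁.v .ok = ρ.v .ok := Cmd.eval_v _ _ _ rfl
  have hstr₁ : ρ₁.a .str = ρ.a .str := Cmd.eval_a _ _ _ rfl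
  have key := Cmd.eval_count (E := E) (x := .j) (b := .q) (p := Cmd.round) (ρ := ρ₁)
    (fun n ρ' => BanRep E ρ' (E.net.bans dig n) ∧ ρ'.v .y = ρ.v .y / (E.par .r + 1) ^ n ∧
      (ρ'.v .ok = 1 ↔ ρ.v .ok = 1 ∧ ∀ j < n, E.net.Feasible (E.net.bans dig j)) ∧
      (0 < n → ∀ i < E.par .r, ρ'.a .str (ρ.v .k) i =
        E.net.str (E.net.bans dig (n - 1)) i) ∧
      ∀ k ≠ ρ.v .k, ρ'.a .str k = ρ.a .str k)
    (by
      refine ⟨fun e he i hi => eval_clearBan hE ρ he hi, by simp [hy₁], by simp [hok₁], by simp,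
        fun k _ => by rw [HState.set_a, hstr₁]⟩)
    (by
      rintro n ρ₂ hn - hfr ⟨h1, h2, h3, h4, h5⟩
      have hk₂ : ρ₂.v .k = ρ.v .k := by rw [hfr .k rfl, hk₁]
      obtain ⟨g1, g2, g3, g4, g5⟩ := eval_round hE h1 (hk₂.symm ▸ hk)
      rw [hk₂] at g4 g5
      refine ⟨?_, ?_, ?_, fun _ i hi => ?_, fun k hk => ?_⟩
      · rw [h2, ← hdig] at g1
        exact g1
      · rw [HState.set_v, if_neg (by decide), g2, h2, pow_succ, Nat.div_div_eq_div_mul]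
      · rw [HState.set_v, if_neg (by decide), g3, h3, and_assoc]
        simp only [Nat.lt_succ_iff_lt_or_eq, or_imp, forall_and, forall_eq]
      · rw [HState.set_a, g4 i hi, Nat.add_sub_cancel]
      · rw [HState.set_a, g5 k hk, h5 k hk])
  exact ⟨key.2.1, key.2.2.1, key.2.2.2.1 hq, key.2.2.2.2⟩

theorem eval_checkPair (hE : E.InRange) {ρ : HState} (hk : ρ.v .k < E.par .K)
    (hl : ρ.v .l < E.par .K) :
    (Cmd.checkPair.eval E ρ).v .ok = 1 ↔ ρ.v .ok = 1 ∧
      E.par .Δ ≤ Net.dist (E.par .r) (ρ.a .str (ρ.v .k)) (ρ.a .str (ρ.v .l)) := by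
  have hst := hE.stride
  have hK := hE.K
  simp only [Cmd.checkPair, Cmd.eval_seq]
  set ρ₁ := Cmd.eval E (.set .h _) ρ with hρ₁
  have key := Cmd.eval_count (E := E) (x := .i) (b := .r)
    (p := .ite .eq (.get .str (.var .k) (.var .i)) (.get .str (.var .l) (.var .i)) .skip
      (.set .h (.sub (.var .h) (.lit 1)))) (ρ := ρ₁)
    (fun n ρ' => ρ'.a = ρ.a ∧
      ρ'.v .h = E.par .Δ - Net.dist n (ρ.a .str (ρ.v .k)) (ρ.a .str (ρ.v .l)))
    (by exact ⟨rfl, by simp [hρ₁, Cmd.eval, Ex.val, Net.dist]⟩)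
    (by
      rintro n ρ₂ hn hi hfr ⟨h1, h2⟩
      have hk₂ : ρ₂.v .k = ρ.v .k := by rw [hfr .k rfl]; simp [hρ₁, Cmd.eval]
      have hl₂ : ρ₂.v .l = ρ.v .l := by rw [hfr .l rfl]; simp [hρ₁, Cmd.eval]
      simp only [Cmd.eval, Ex.val, Ex.sub, ArithOp.eval, Cmp.holds, hi, hk₂, hl₂, h1, h2,
        Nat.mod_eq_of_lt (show ρ.v .k < E.par .P by omega),
        Nat.mod_eq_of_lt (show ρ.v .l < E.par .P by omega),
        Nat.mod_eq_of_lt (show n < E.par .stride by omega), Net.dist,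
        Finset.range_add_one, Finset.filter_insert]
      by_cases h : ρ.a .str (ρ.v .k) n = ρ.a .str (ρ.v .l) n
      · simp [h, h1, h2, Net.dist]
      · simp [h, h1, Nat.sub_sub])
  set ρ₂ := Cmd.eval E (.count .i .r _) ρ₁ with hρ₂
  have hok₂ : ρ₂.v .ok = ρ.v .ok := by
    rw [hρ₂, Cmd.eval_v _ _ _ rfl]
    simp [hρ₁, Cmd.eval]
  simp only [Cmd.eval, Ex.val, Cmp.holds, key.2, Fin.val_zero, Nat.sub_eq_zero_iff_le]
  by_cases h : E.par .Δ ≤ Net.dist (E.par .r) (ρ.a .str (ρ.v .k)) (ρ.a .str (ρ.v .l))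
  · simp [h, hok₂]
  · simp [h]

theorem eval_check (hE : E.InRange) (ρ : HState) :
    (Cmd.check.eval E ρ).v .ok = 1 ↔ ρ.v .ok = 1 ∧ ∀ k < E.par .K, ∀ l < E.par .K, l < k →
      E.par .Δ ≤ Net.dist (E.par .r) (ρ.a .str k) (ρ.a .str l) := by
  refine (Cmd.eval_count (E := E) (fun n ρ' => ρ'.a = ρ.a ∧ (ρ'.v .ok = 1 ↔ ρ.v .ok = 1 ∧
    ∀ k < n, ∀ l < E.par .K, l < k →
      E.par .Δ ≤ Net.dist (E.par .r) (ρ.a .str k) (ρ.a .str l))) ⟨rfl, by simp⟩ ?_).2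
  rintro n ρ₁ hn hk - ⟨h1, h2⟩
  have key := Cmd.eval_count (E := E) (x := .l) (b := .K)
    (p := .ite .lt (.var .l) (.var .k) .checkPair .skip) (ρ := ρ₁)
    (fun m ρ' => ρ'.a = ρ.a ∧ (ρ'.v .ok = 1 ↔ ρ₁.v .ok = 1 ∧ ∀ l < m, l < n →
      E.par .Δ ≤ Net.dist (E.par .r) (ρ.a .str n) (ρ.a .str l)))
    (by exact ⟨h1, by simp⟩)
    (by
      rintro m ρ₂ hm hl hfr ⟨g1, g2⟩
      have hk₂ : ρ₂.v .k = n := by rw [hfr .k rfl, hk]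
      refine ⟨?_, ?_⟩
      · rw [HState.set_a, ← g1]
        funext u
        exact Cmd.eval_a _ _ _ (by cases u <;> rfl)
      · rw [HState.set_v, if_neg (by decide), Cmd.eval]
        simp only [Ex.val, hl, hk₂, Cmp.holds, Nat.lt_succ_iff_lt_or_eq, or_imp, forall_and,
          forall_eq, ← and_assoc, ← g2]
        by_cases hmn : m < n
        · rw [if_pos hmn, eval_checkPair hE (hk₂.symm ▸ hn) (hl.symm ▸ hm), hk₂, hl, g1]
          simp [hmn]
        · simp [hmn, Cmd.eval])
  refine ⟨key.1, ?_⟩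
  rw [HState.set_v, if_neg (by decide), key.2, h2, and_assoc]
  simp only [Nat.lt_succ_iff_lt_or_eq (n := n), or_imp, forall_and, forall_eq]

theorem eval_tryNumber (hE : E.InRange) (hq : E.par .q = E.par .r * E.par .K + 1) (ρ : HState) :
    (Cmd.tryNumber.eval E ρ).v .ok = 1 ↔ E.net.Accepts (E.par .K) (E.par .Δ) (ρ.v .z) := by
  have hq' : E.net.rounds (E.par .K) = E.par .q := by rw [hq]; rfl
  simp only [Cmd.tryNumber, Cmd.eval_seq]
  set ρ₁ := Cmd.eval E (.set .y _) ρ with hρ₁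
  set ρ₂ := Cmd.eval E (.set .ok _) ρ₁ with hρ₂
  have hy₂ : ρ₂.v .y = ρ.v .z := by simp [hρ₂, hρ₁, Cmd.eval, Ex.val]
  have hok₂ : ρ₂.v .ok = 1 := by simp [hρ₂, Cmd.eval, Ex.val]
  have key := Cmd.eval_count (E := E) (x := .k) (b := .K) (p := .buildStr) (ρ := ρ₂)
    (fun n ρ' => ρ'.v .y = ρ.v .z / (E.par .r + 1) ^ (n * E.par .q) ∧
      (ρ'.v .ok = 1 ↔ ∀ k < n, ∀ j < E.par .q,
        E.net.Feasible (E.net.bans (E.net.digit (E.par .K) (ρ.v .z) k) j)) ∧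
      ∀ k < n, ∀ i < E.par .r, ρ'.a .str k i = E.net.out (E.par .K) (ρ.v .z) k i)
    (by exact ⟨by simp [hy₂], by simp [hok₂], by simp⟩)
    (by
      rintro n ρ₃ hn hk - ⟨h1, h2, h3⟩
      obtain ⟨g1, g2, g3, g4⟩ := eval_buildStr hE (by omega) (hk.symm ▸ hn)
        (dig := E.net.digit (E.par .K) (ρ.v .z) n) (by
          intro j
          rw [h1, Nat.div_div_eq_div_mul, ← pow_add, Net.digit, hq']
          rfl)
      rw [hk] at g3 g4
      refine ⟨?_, ?_, fun k hk i hi => ?_⟩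
      · rw [HState.set_v, if_neg (by decide), g1, h1, Nat.div_div_eq_div_mul, ← pow_add,
          Nat.succ_mul]
      · rw [HState.set_v, if_neg (by decide), g2, h2]
        simp only [Nat.lt_succ_iff_lt_or_eq (n := n), or_imp, forall_and, forall_eq]
      · rw [HState.set_a]
        rcases Nat.lt_succ_iff_lt_or_eq.1 hk with hk' | rfl
        · rw [g4 k hk'.ne, h3 k hk' i hi]
        · rw [g3 i hi, Net.out, hq'])
  set ρ₃ := Cmd.eval E (.count .k .K .buildStr) ρ₂ with hρ₃
  obtain ⟨-, h2, h3⟩ := key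
  rw [Cmd.eval_v _ _ _ rfl, eval_check hE, h2, Net.Accepts, hq']
  refine and_congr_right fun _ => forall₂_congr fun k hk => forall₂_congr fun l hl => ?_
  have : Net.dist (E.par .r) (ρ₃.a .str k) (ρ₃.a .str l) = Net.dist E.net.r
      (E.net.out (E.par .K) (ρ.v .z) k) (E.net.out (E.par .K) (ρ.v .z) l) := by
    unfold Net.dist
    congr 1
    refine Finset.filter_congr fun i hi => ?_
    have hi' : i < E.par .r := Finset.mem_range.1 hi
    rw [h3 k hk i hi', h3 l hl i hi']
  rw [this]

/-- The program tells whether some number leads to a solution. -/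
theorem eval_search (hE : E.InRange) (hq : E.par .q = E.par .r * E.par .K + 1) (ρ : HState) :
    ((∃ z < E.par .N, E.net.Accepts (E.par .K) (E.par .Δ) z) →
      (Cmd.search.eval E ρ).v .ans = 1) ∧
    ((¬ ∃ z < E.par .N, E.net.Accepts (E.par .K) (E.par .Δ) z) →
      (Cmd.search.eval E ρ).v .ans = 0) := by
  rw [Cmd.search, Cmd.eval]
  refine Cmd.eval_count (E := E) (fun n ρ' =>
    ((∃ z < n, E.net.Accepts (E.par .K) (E.par .Δ) z) → ρ'.v .ans = 1) ∧
    ((¬ ∃ z < n, E.net.Accepts (E.par .K) (E.par .Δ) z) → ρ'.v .ans = 0)) ?_ ?_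
  · simp [Cmd.eval, Ex.val]
  · rintro n ρ₁ hn hz - ⟨h1, h2⟩
    have hok := eval_tryNumber hE hq ρ₁
    rw [hz] at hok
    simp only [HState.set_v, reduceCtorEq, if_false, Nat.lt_succ_iff_lt_or_eq (n := n),
      or_and_right, exists_or, exists_eq_left]
    simp only [Cmd.tryNumber, Cmd.eval_seq, Cmd.eval_ite, Ex.val, Cmp.holds, Fin.val_one] at hok ⊢
    set ρ₂ := Cmd.eval E .check _ with hρ₂
    have hans : ρ₂.v .ans = ρ₁.v .ans := by
      rw [hρ₂, Cmd.eval_v _ _ _ rfl, Cmd.eval_v _ _ _ rfl]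
      simp [Cmd.eval]
    by_cases hA : ρ₂.v .ok = 1
    · simp only [hA, if_true] at hok ⊢
      have := hok.1 (by simp [Cmd.eval, hA])
      simp [this, Cmd.eval, Ex.val]
    · simp only [hA, if_false, Cmd.eval, false_iff] at hok ⊢
      simp only [hok, or_false, hans]
      exact ⟨h1, h2⟩

/-! ### Setting up the parameters -/

/-- The environment of a run on the input words `l`. Replacing `Δ` by `Δ - 1 + 1`, which is
`max Δ 1`, makes strings at distance at least `Δ` distinct. -/
def envOf (l : List ℕ) : Env where
  inp m := l.getD m 0
  par
    | .K => l.getD 0 0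
    | .r => l.getD 1 0
    | .Δ => l.getD 2 0 - 1 + 1
    | .M => l.getD 5 0
    | .s => l.getD 6 0
    | .t => l.getD 7 0
    | .stride => l.getD 1 0 + 1
    | .P => l.getD 5 0 + l.getD 0 0 + 1
    | .base => 8 + 3 * (l.getD 5 0 + l.getD 0 0 + 1)
    | .q => l.getD 1 0 * l.getD 0 0 + 1
    | .N => (l.getD 1 0 + 1) ^ (l.getD 0 0 * (l.getD 1 0 * l.getD 0 0 + 1))

/-- Load `K`, `r`, `Δ`, `M`, `s` and `t` from the header of the input into their registers. -/
def loadHeader : RamProg :=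
  .seq (.const 32 0) <| .seq (.load 19 32) <| .seq (.const 32 1) <| .seq (.load 20 32) <|
  .seq (.const 32 2) <| .seq (.load 21 32) <| .seq (.const 32 5) <| .seq (.load 22 32) <|
  .seq (.const 32 6) <| .seq (.load 23 32) <| .seq (.const 32 7) (.load 24 32)

/-- Compute the parameters that are not part of the input, except `N`. At the end, register `34`
holds the exponent `K * q` for `computePow`. -/
def computePars : RamProg :=
  .seq (.const 33 1) <| .seq (.arith .sub 21 21 33) <| .seq (.arith .add 21 21 33) <|
  .seq (.arith .add 16 20 33) <| .seq (.arith .add 17 22 19) <| .seq (.arith .add 17 17 33) <|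
  .seq (.const 32 3) <| .seq (.arith .mul 18 32 17) <| .seq (.const 32 8) <|
  .seq (.arith .add 18 32 18) <| .seq (.arith .mul 25 20 19) <| .seq (.arith .add 25 25 33) <|
  .seq (.const 26 1) <| .seq (.arith .mul 34 19 25) (.const 35 0)

/-- Compute `N`, a power of `r + 1`, with register `35` as the counter. -/
def computePow : RamProg :=
  .loop (.lt 35 34) (.seq (.arith .mul 26 26 16) (.arith .add 35 35 33))

/-- Compute all parameters. -/
def setup : RamProg := .seq loadHeader (.seq computePars computePow)

/-- After the setup, the machine represents the state in which all variables and arrays are `0`: the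
arrays lie behind the input, where the memory is still empty. -/
theorem setup_runs {l : List ℕ} {w : ℕ} (hfit : (envOf l).Fits w)
    (hKq : (envOf l).par .K * (envOf l).par .q < 2 ^ w)
    (hlen : l.length ≤ (envOf l).par .base) :
    Runs w setup (inputState l)
      (12 + (15 + ((envOf l).par .K * (envOf l).par .q * (2 + 1) + 1)))
      (Rep (envOf l) ⟨fun _ => 0, fun _ _ _ => 0⟩) := by
  have hlit := hfit.lit
  have hP := hfit.par .P
  have hst := hfit.par .stride
  have hb := hfit.par .base
  have hq := hfit.par .q
  have hN := hfit.par .N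
  have hΔ := hfit.par .Δ
  have hΔ0 := hfit.inp 2
  generalize hE : envOf l = E at *
  have eK : l.getD 0 0 = E.par .K := by rw [← hE]; rfl
  have er : l.getD 1 0 = E.par .r := by rw [← hE]; rfl
  have eM : l.getD 5 0 = E.par .M := by rw [← hE]; rfl
  have es : l.getD 6 0 = E.par .s := by rw [← hE]; rfl
  have et : l.getD 7 0 = E.par .t := by rw [← hE]; rfl
  have eΔ : l.getD 2 0 - 1 + 1 = E.par .Δ := by rw [← hE]; rfl
  have eΔ0 : l.getD 2 0 < 2 ^ w := by rw [← hE] at hΔ0; exact hΔ0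
  have eP : E.par .M + E.par .K + 1 = E.par .P := by rw [← hE]; rfl
  have est : E.par .r + 1 = E.par .stride := by rw [← hE]; rfl
  have eb : 8 + 3 * E.par .P = E.par .base := by rw [← hE]; rfl
  have eq : E.par .r * E.par .K + 1 = E.par .q := by rw [← hE]; rfl
  have eN : E.par .stride ^ (E.par .K * E.par .q) = E.par .N := by rw [← hE]; rfl
  have einp : ∀ m, l.getD m 0 = E.inp m := by intro m; rw [← hE]; rfl
  refine Runs.seq (Runs.mono (B := 12) (Q := fun τ => τ.mem = (inputState l).mem ∧
      (∀ x < 16, τ.reg x = 0) ∧ τ.reg 19 = E.par .K ∧ τ.reg 20 = E.par .r ∧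
      τ.reg 21 = l.getD 2 0 ∧ τ.reg 22 = E.par .M ∧ τ.reg 23 = E.par .s ∧
      τ.reg 24 = E.par .t) ?_ le_rfl ?_)
  · rw [← eK, ← er, ← eM, ← es, ← et]
    unfold loadHeader
    refine Runs.mono (B := 1 + (1 + (1 + (1 + (1 + (1 + (1 + (1 + (1 + (1 + (1 + 1)))))))))))
      (Runs.seq (Runs.const (by omega) (Runs.seq (Runs.load (Runs.seq (Runs.const (by omega)
      (Runs.seq (Runs.load (Runs.seq (Runs.const (by omega) (Runs.seq (Runs.load (Runs.seq
      (Runs.const (by omega) (Runs.seq (Runs.load (Runs.seq (Runs.const (by omega) (Runs.seq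
      (Runs.load (Runs.seq (Runs.const (by omega) (Runs.load ?_)))))))))))))))))))))))
      (by omega) (fun _ h => h)
    refine ⟨rfl, fun x hx => ?_, ?_⟩
    · simp [inputState, show x ≠ 19 by omega, show x ≠ 20 by omega, show x ≠ 21 by omega,
        show x ≠ 22 by omega, show x ≠ 23 by omega, show x ≠ 24 by omega, show x ≠ 32 by omega]
    · simp [inputState]
  rintro τ ⟨hm, h0, h19, h20, h21, h22, h23, h24⟩
  refine Runs.seq (Runs.mono (B := 15) (Q := fun τ => τ.mem = (inputState l).mem ∧
      (∀ x < 16, τ.reg x = 0) ∧ τ.reg 19 = E.par .K ∧ τ.reg 20 = E.par .r ∧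
      τ.reg 21 = E.par .Δ ∧ τ.reg 22 = E.par .M ∧ τ.reg 23 = E.par .s ∧
      τ.reg 24 = E.par .t ∧ τ.reg 16 = E.par .stride ∧ τ.reg 17 = E.par .P ∧
      τ.reg 18 = E.par .base ∧ τ.reg 25 = E.par .q ∧ τ.reg 33 = 1 ∧
      τ.reg 34 = E.par .K * E.par .q ∧ τ.reg 26 = 1 ∧ τ.reg 35 = 0) ?_ le_rfl ?_)
  · unfold computePars
    refine Runs.mono (B := 1 + (1 + (1 + (1 + (1 + (1 + (1 + (1 + (1 + (1 + (1 + (1 + (1 +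
      (1 + 1))))))))))))))
      (Runs.seq (Runs.const ?_ (Runs.seq (Runs.arith ?_ (Runs.seq (Runs.arith ?_
      (Runs.seq (Runs.arith ?_ (Runs.seq (Runs.arith ?_ (Runs.seq (Runs.arith ?_
      (Runs.seq (Runs.const ?_ (Runs.seq (Runs.arith ?_ (Runs.seq (Runs.const ?_
      (Runs.seq (Runs.arith ?_ (Runs.seq (Runs.arith ?_ (Runs.seq (Runs.arith ?_
      (Runs.seq (Runs.const ?_ (Runs.seq (Runs.arith ?_
      (Runs.const ?_ ?_)))))))))))))))))))))))))))))
      (by omega) (fun _ h => h)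
    on_goal 16 =>
      refine ⟨hm, fun x hx => ?_, ?_⟩
      · simp [h0 x hx, show x ≠ 16 by omega, show x ≠ 17 by omega, show x ≠ 18 by omega,
          show x ≠ 21 by omega, show x ≠ 25 by omega, show x ≠ 26 by omega,
          show x ≠ 32 by omega, show x ≠ 33 by omega, show x ≠ 34 by omega,
          show x ≠ 35 by omega]
      · simp [ArithOp.eval, *]
        simpa using eΔ
    all_goals try simp only [setReg_reg, ArithOp.eval, h19, h20, h21, h22]
    all_goals try simp only [Nat.reduceEqDiff, if_true, if_false, eP, eb, eq]
    all_goals first | assumption | omega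
  rintro τ ⟨hm, h0, h19, h20, h21, h22, h23, h24, h16, h17, h18, h25, h33, h34, h26, h35⟩
  unfold computePow
  refine Runs.mono (Runs.loop (B := 2) (E.par .K * E.par .q) (fun n υ => υ.mem = τ.mem ∧
    (∀ x < 34, x ≠ 26 → υ.reg x = τ.reg x) ∧ υ.reg 34 = τ.reg 34 ∧
      υ.reg 26 = E.par .stride ^ n ∧ υ.reg 35 = n) ⟨rfl, fun _ _ _ => rfl, rfl, by simp [h26], h35⟩
      ?_ ?_) le_rfl ?_
  · rintro n hn υ ⟨g1, g2, g3, g4, g5⟩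
    refine ⟨by simp only [RegTest.holds, g5, g3, h34, hn], ?_⟩
    have g16 := g2 16 (by omega) (by omega)
    have g33 := g2 33 (by omega) (by omega)
    have hpow : E.par .stride ^ (n + 1) ≤ E.par .N := by
      rw [← eN]
      exact Nat.pow_le_pow_right hfit.pos_stride hn
    refine Runs.seq (B₁ := 1) (B₂ := 1) (Runs.arith ?_ (Runs.arith ?_ ?_))
    · simp only [ArithOp.eval, g4, g16, h16, ← pow_succ]
      omega
    · simp [ArithOp.eval, g5, g33, h33]
      omega
    · refine ⟨by simp [g1], fun x hx hx' => ?_, ?_⟩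
      · simp [hx', show x ≠ 35 by omega, g2 x hx hx']
      · simp [ArithOp.eval, g3, g4, g5, g16, g33, h16, h33, pow_succ]
  · rintro υ ⟨g1, g2, g3, g4, g5⟩
    simp [RegTest.holds, g3, g5, h34]
  · rintro υ ⟨g1, g2, g3, g4, g5⟩
    refine ⟨fun x => ?_, fun p => ?_, fun u i j hi hj => ?_, fun m _ => ?_⟩
    · have := x.reg_lt
      rw [g2 _ (by omega) (by omega), h0 _ this]
    · cases p <;> simp only [Par.reg] <;>
        first
          | rw [g4, eN]
          | rw [g2 _ (by omega) (by omega)]; assumption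
    · rw [g1, hm]
      exact List.getD_eq_default _ _ (hlen.trans (Nat.le_add_left _ _))
    · rw [g1, hm]
      exact einp m

/-! ### The running time -/

/-- The parameters that bound the loops of a program. -/
def Cmd.bounds : Cmd → List Par
  | skip => []
  | set _ _ => []
  | put _ _ _ _ => []
  | seq p q => p.bounds ++ q.bounds
  | ite _ _ _ p q => p.bounds ++ q.bounds
  | .count _ b p => b :: p.bounds

theorem Cmd.cost_mono {π π' : Par → ℕ} (p : Cmd) (h : ∀ b ∈ p.bounds, π b ≤ π' b) :
    p.cost π ≤ p.cost π' := by
  induction p with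
  | skip => exact le_rfl
  | set => exact le_rfl
  | put => exact le_rfl
  | seq p q ihp ihq =>
    simp only [Cmd.bounds, List.mem_append] at h
    exact Nat.add_le_add (ihp fun b hb => h b (.inl hb)) (ihq fun b hb => h b (.inr hb))
  | ite c a b p q ihp ihq =>
    simp only [Cmd.bounds, List.mem_append] at h
    have := ihp fun b hb => h b (.inl hb)
    have := ihq fun b hb => h b (.inr hb)
    simp only [Cmd.cost]
    omega
  | count x b p ih =>
    simp only [Cmd.bounds, List.mem_cons, forall_eq_or_imp] at h
    have := h.1
    have := ih h.2
    simp only [Cmd.cost]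
    gcongr

theorem cost_tryNumber_const (Y : ℕ) :
    Cmd.tryNumber.cost (fun _ => Y) = 19 + Y * 12 + Y ^ 2 * 114 + Y ^ 3 * 160 + Y ^ 4 * 88 := by
  simp only [Cmd.tryNumber, Cmd.check, Cmd.checkPair, Cmd.buildStr, Cmd.round, Cmd.useDigit,
    Cmd.readStr, Cmd.fillNx, Cmd.fillRow, Cmd.clearNx, Cmd.clearBan, Cmd.cost, Ex.cost, Ex.sub,
    Ex.div, Ex.mod, Ex.tl, Ex.lb, Ex.hd]
  ring

/-- One number is tried in time `O(Y ^ 4)` if all loop bounds are at most `Y`. -/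
theorem cost_tryNumber_le {π : Par → ℕ} {Y : ℕ} (hY : 1 ≤ Y)
    (h : ∀ p, p = .N ∨ p = .base ∨ p = .Δ ∨ p = .s ∨ p = .t ∨ π p ≤ Y) :
    Cmd.tryNumber.cost π ≤ 393 * Y ^ 4 := by
  have hb : ∀ b ∈ Cmd.tryNumber.bounds, π b ≤ Y := by
    intro b hb
    refine (h b).resolve_left ?_ |>.resolve_left ?_ |>.resolve_left ?_ |>.resolve_left ?_
      |>.resolve_left ?_ <;> rintro rfl <;> revert hb <;> decide
  refine (Cmd.cost_mono (π' := fun _ => Y) _ hb).trans ?_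
  rw [cost_tryNumber_const]
  have h1 : 1 ≤ Y ^ 4 := Nat.one_le_pow _ _ hY
  have h2 : Y ≤ Y ^ 4 := Nat.le_self_pow (by decide) Y
  have h3 : Y ^ 2 ≤ Y ^ 4 := Nat.pow_le_pow_right hY (by decide)
  have h4 : Y ^ 3 ≤ Y ^ 4 := Nat.pow_le_pow_right hY (by decide)
  omega

/-! ### Instances and their encoding -/

theorem flatMap_triple_getD {α : Type} (f g h : α → ℕ) (l : List α) (e : ℕ) (he : e < l.length) :
    (l.flatMap fun a => [f a, g a, h a]).getD (3 * e) 0 = f l[e] ∧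
      (l.flatMap fun a => [f a, g a, h a]).getD (3 * e + 1) 0 = g l[e] ∧
      (l.flatMap fun a => [f a, g a, h a]).getD (3 * e + 2) 0 = h l[e] := by
  induction l generalizing e with
  | nil => simp at he
  | cons a l ih =>
    cases e with
    | zero => simp
    | succ e =>
      have := ih e (by simpa using he)
      simpa [Nat.mul_succ, Nat.add_right_comm _ 3] using this

theorem encode_length (I : DiverseInstance) : I.encode.length = 8 + 3 * I.edges.length := by
  simp only [DiverseInstance.encode, List.length_append, List.length_flatMap, List.length_cons,
    List.length_nil, List.map_const', List.sum_replicate, smul_eq_mul]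
  omega

variable (I : DiverseInstance)

theorem word_encode {e : ℕ} (he : e < I.edges.length) :
    (envOf I.encode).word 0 e = I.edges[e].1 ∧ (envOf I.encode).word 1 e = I.edges[e].2.1 ∧
      (envOf I.encode).word 2 e = I.edges[e].2.2 := by
  have hP : e % (envOf I.encode).par .P = e := by
    refine Nat.mod_eq_of_lt ?_
    show e < I.edges.length + I.K + 1
    omega
  have h := flatMap_triple_getD (fun a : Fin I.n × Fin I.σ × Fin I.n => (a.1 : ℕ))
    (fun a => (a.2.1 : ℕ)) (fun a => (a.2.2 : ℕ)) I.edges e he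
  simp only [Env.word, hP]
  simp only [envOf, DiverseInstance.encode]
  refine ⟨?_, ?_, ?_⟩
  · rw [List.getD_append_right _ _ _ _ (by simp), ← h.1]
    congr 1
    simp
  · rw [List.getD_append_right _ _ _ _ (by simp; omega), ← h.2.1]
    congr 1
    simp
    omega
  · rw [List.getD_append_right _ _ _ _ (by simp; omega), ← h.2.2]
    congr 1
    simp
    omega

theorem word_encode_of_le {e : ℕ} (he : I.edges.length ≤ e % (envOf I.encode).par .P)
    (c : Fin 3) : (envOf I.encode).word c e = 0 := by
  unfold Env.word
  refine List.getD_eq_default _ _ ?_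
  rw [encode_length]
  omega

/-- Every vertex but the source is the head of an edge. -/
theorem vertices_le : I.n ≤ I.edges.length + 1 := by
  classical
  have hsub : (Finset.univ : Finset (Fin I.n)) ⊆
      insert I.G.s (I.edges.toFinset.image fun e => e.2.2) := by
    intro v _
    by_cases hv : v = I.G.s
    · simp [hv]
    · have := (I.G.source_unique v).not.2 hv
      push Not at this
      obtain ⟨e, he, rfl⟩ := this
      refine Finset.mem_insert_of_mem (Finset.mem_image_of_mem _ ?_)
      rw [List.mem_toFinset, I.mem_edges]
      exact he
  calc I.n = (Finset.univ : Finset (Fin I.n)).card := by simp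
    _ ≤ _ := Finset.card_le_card hsub
    _ ≤ _ := Finset.card_insert_le _ _
    _ ≤ _ := Nat.add_le_add_right (Finset.card_image_le.trans (List.toFinset_card_le _)) 1

theorem inRange : (envOf I.encode).InRange where
  stride := rfl
  posP := Nat.succ_pos _
  M := (Nat.le_add_right _ _).trans (Nat.le_succ _)
  K := (Nat.le_add_left _ _).trans (Nat.le_succ _)
  s := by
    show (I.G.s : ℕ) < I.edges.length + I.K + 1
    have := vertices_le I
    have := I.G.s.isLt
    have := I.one_le_K
    omega
  t := by
    show (I.G.t : ℕ) < I.edges.length + I.K + 1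
    have := vertices_le I
    have := I.G.t.isLt
    have := I.one_le_K
    omega
  word := by
    intro c e hc
    have hP : (envOf I.encode).par .P = I.edges.length + I.K + 1 := rfl
    rcases lt_or_ge (e % (envOf I.encode).par .P) I.edges.length with he | he
    · have hmod : (envOf I.encode).word c e =
          (envOf I.encode).word c (e % (envOf I.encode).par .P) := by simp [Env.word]
      obtain ⟨h0, -, h2⟩ := word_encode I he
      have := vertices_le I
      have := I.one_le_K
      have hc' : c = 0 ∨ c = 2 := by clear hmod; revert c; decide
      rcases hc' with rfl | rfl
      · rw [hmod, h0]
        have := (I.edges[e % (envOf I.encode).par .P]).1.isLt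
        omega
      · rw [hmod, h2]
        have := (I.edges[e % (envOf I.encode).par .P]).2.2.isLt
        omega
    · rw [word_encode_of_le I he]
      omega

/-- The walks to the sink in the numbered graph are the paths of the given graph. -/
theorem walk_iff {m : ℕ} (hm : m ≤ I.r) (u : Fin I.n) (x : ℕ → ℕ) :
    (envOf I.encode).net.Walk m u x ↔ ∃ P, IsPath I.G.E u P I.G.t ∧
      (pathString P).map Fin.val = (List.range m).map fun i => x (I.r - m + i) := by
  induction m generalizing u with
  | zero =>
    have h1 : (envOf I.encode).net.Walk 0 u x ↔ u = I.G.t := Fin.ext_iff.symm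
    rw [h1]
    constructor
    · rintro rfl
      exact ⟨[], rfl, by simp [pathString]⟩
    · rintro ⟨P, hP, h⟩
      obtain rfl : P = [] := by simpa [pathString] using h
      exact hP
  | succ m ih =>
    have hr : (envOf I.encode).net.r = I.r := rfl
    have hM : (envOf I.encode).net.M = I.edges.length := rfl
    have htail : ((List.range (m + 1)).map fun i => x (I.r - (m + 1) + i)) =
        x (I.r - (m + 1)) :: (List.range m).map fun i => x (I.r - m + i) := by
      rw [List.range_succ_eq_map, List.map_cons, List.map_map]
      refine congrArg₂ _ rfl (List.map_congr_left fun i _ => ?_)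
      simp only [Function.comp_apply]
      congr 1
      omega
    simp only [Net.Walk, hr, hM, htail]
    constructor
    · rintro ⟨e, he, h1, h2, h3⟩
      obtain ⟨w0, w1, w2⟩ := word_encode I he
      replace h3 : (envOf I.encode).net.Walk m (I.edges[e].2.2 : ℕ) x := by
        rw [← w2]; exact h3
      obtain ⟨P, hP, h⟩ := (ih (by omega) _).1 h3
      refine ⟨I.edges[e] :: P, ⟨(I.mem_edges _).1 (List.getElem_mem he), ?_, hP⟩, ?_⟩
      · exact Fin.ext (w0.symm.trans h1)
      · have : (I.edges[e].2.1 : ℕ) = x (I.r - (m + 1)) := w1.symm.trans h2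
        rw [← h, ← this]
        rfl
    · rintro ⟨P, hP, h⟩
      cases P with
      | nil => simp [pathString] at h
      | cons e P =>
        obtain ⟨he, rfl, hP⟩ := hP
        obtain ⟨j, hj, rfl⟩ := List.getElem_of_mem ((I.mem_edges e).2 he)
        obtain ⟨w0, w1, w2⟩ := word_encode I hj
        simp only [pathString, List.map_cons, List.cons.injEq] at h
        refine ⟨j, hj, w0, w1.trans h.1, ?_⟩
        have := (ih (by omega) _).2 ⟨P, hP, h.2⟩
        rw [← w2] at this
        exact this

theorem lang_iff (x : ℕ → ℕ) : (envOf I.encode).net.Lang x ↔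
    ∃ y : Fin I.r → Fin I.σ, List.ofFn y ∈ I.G.lang ∧ ∀ i : Fin I.r, x i = y i := by
  have h := walk_iff I le_rfl I.G.s x
  rw [Nat.sub_self] at h
  simp only [zero_add] at h
  refine h.trans ⟨?_, ?_⟩
  · rintro ⟨P, hP, h⟩
    have hmem : pathString P ∈ I.G.lang := ⟨P, hP, rfl⟩
    have hlen : (pathString P).length = I.r := I.lang_length _ hmem
    refine ⟨fun i => (pathString P)[i], ?_, fun i => ?_⟩
    · have : List.ofFn (fun i : Fin I.r => (pathString P)[i]) = pathString P := by
        refine List.ext_getElem (by simp [hlen]) fun i h1 h2 => by simp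
      rwa [this]
    · have := congrArg (fun l => l[(i : ℕ)]?) h
      simp [hlen] at this
      simpa using this.symm
  · rintro ⟨y, ⟨P, hP, h⟩, hxy⟩
    refine ⟨P, hP, ?_⟩
    rw [h]
    refine List.ext_getElem (by simp) fun i h1 h2 => ?_
    have hi : i < I.r := by simpa using h1
    simpa using (hxy ⟨i, hi⟩).symm

theorem dist_eq_hammingDist {r σ : ℕ} {x x' : ℕ → ℕ} {y y' : Fin r → Fin σ}
    (h : ∀ i : Fin r, x i = y i) (h' : ∀ i : Fin r, x' i = y' i) :
    Net.dist r x x' = hammingDist y y' := by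
  unfold Net.dist hammingDist
  rw [Finset.card_filter, Finset.card_filter, ← Fin.sum_univ_eq_sum_range
    (fun i => if x i ≠ x' i then 1 else 0)]
  refine Finset.sum_congr rfl fun i _ => ?_
  simp [h, h', Fin.ext_iff]

/-- A solution is a family of `K` strings of the language with pairwise distance at
least `max Δ 1`. -/
theorem yes_iff : I.yes ↔ ∃ X : ℕ → ℕ → ℕ,
    (∀ k < I.K, (envOf I.encode).net.Lang (X k)) ∧
      ∀ k < I.K, ∀ l < I.K, l < k → I.Δ - 1 + 1 ≤ Net.dist I.r (X k) (X l) := by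
  constructor
  · rintro ⟨X, hL, hcard, hdiv⟩
    have e : Fin I.K ≃ X := (finCongr hcard.symm).trans X.equivFin.symm
    let x : ℕ → ℕ → ℕ := fun k i =>
      if h : k < I.K ∧ i < I.r then ((e ⟨k, h.1⟩ : Fin I.r → Fin I.σ) ⟨i, h.2⟩ : ℕ) else 0
    have hx : ∀ k (hk : k < I.K) (i : Fin I.r), x k i = (e ⟨k, hk⟩ : Fin I.r → Fin I.σ) i := by
      intro k hk i
      simp [x, hk]
    refine ⟨x, fun k hk => (lang_iff I _).2 ⟨_, hL _ (e ⟨k, hk⟩).2, hx k hk⟩, ?_⟩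
    intro k hk l hl hlk
    rw [dist_eq_hammingDist (hx k hk) (hx l hl)]
    have hne : (e ⟨k, hk⟩ : Fin I.r → Fin I.σ) ≠ e ⟨l, hl⟩ := by
      intro h
      have := e.injective (Subtype.ext h)
      simp only [Fin.mk.injEq] at this
      omega
    have h1 := hammingDist_pos.2 hne
    have h2 : (I.Δ : ℕ∞) ≤ hammingDist (e ⟨k, hk⟩ : Fin I.r → Fin I.σ) (e ⟨l, hl⟩) :=
      hdiv.trans (iInf₂_le_of_le _ (e ⟨k, hk⟩).2 (iInf₂_le_of_le _ (e ⟨l, hl⟩).2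
        (iInf_le _ hne)))
    rw [Nat.cast_le] at h2
    omega
  · rintro ⟨X, hL, hd⟩
    have hL' : ∀ k : Fin I.K, ∃ y : Fin I.r → Fin I.σ, List.ofFn y ∈ I.G.lang ∧
        ∀ i : Fin I.r, X k i = y i := fun k => (lang_iff I _).1 (hL k k.isLt)
    choose y hy hxy using hL'
    have hdist : ∀ k l, k ≠ l → I.Δ - 1 + 1 ≤ hammingDist (y k) (y l) := by
      intro k l hkl
      rcases lt_or_gt_of_ne hkl with h | h
      · rw [hammingDist_comm, ← dist_eq_hammingDist (hxy l) (hxy k)]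
        exact hd l l.isLt k k.isLt h
      · rw [← dist_eq_hammingDist (hxy k) (hxy l)]
        exact hd k k.isLt l l.isLt h
    refine ⟨Finset.univ.image y, ?_, ?_, ?_⟩
    · intro x hx
      obtain ⟨k, -, rfl⟩ := Finset.mem_image.1 hx
      exact hy k
    · rw [Finset.card_image_of_injective, Finset.card_univ, Fintype.card_fin]
      intro k l hkl
      by_contra hne
      have := hdist k l hne
      rw [hkl, hammingDist_self] at this
      omega
    · refine le_iInf₂ fun x hx => le_iInf₂ fun x' hx' => le_iInf fun hne => ?_
      obtain ⟨k, -, rfl⟩ := Finset.mem_image.1 hx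
      obtain ⟨l, -, rfl⟩ := Finset.mem_image.1 hx'
      have := hdist k l (by rintro rfl; exact hne rfl)
      rw [Nat.cast_le]
      omega

/-! ### The algorithm and its bound -/

/-- The factor of the running time that depends on the parameters `r` and `K`. -/
def paramFactor (x : ℕ × ℕ) : ℕ :=
  500 * ((x.1 + x.2 + 2) ^ 8 * (x.1 + 1) ^ (x.2 * (x.1 * x.2 + 1)))

theorem computable_paramFactor : Computable paramFactor := by
  have hpow : Primrec₂ ((· ^ ·) : ℕ → ℕ → ℕ) := Primrec₂.unpaired'.1 Nat.Primrec.pow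
  have h1 : Primrec (Prod.fst : ℕ × ℕ → ℕ) := Primrec.fst
  have h2 : Primrec (Prod.snd : ℕ × ℕ → ℕ) := Primrec.snd
  have add := Primrec.nat_add
  have mul := Primrec.nat_mul
  refine Primrec.to_comp (mul.comp (Primrec.const 500) (mul.comp
    (hpow.comp (add.comp (add.comp h1 h2) (Primrec.const 2)) (Primrec.const 8))
    (hpow.comp (add.comp h1 (Primrec.const 1))
      (mul.comp h2 (add.comp (mul.comp h1 h2) (Primrec.const 1))))))

/-- All loop bounds of the search, except `N`, are at most `Y = (r + K + 2)² |x|`. -/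
theorem par_le (p : Par) : p = .N ∨ p = .base ∨ p = .Δ ∨ p = .s ∨ p = .t ∨
    (envOf I.encode).par p ≤ (I.r + I.K + 2) ^ 2 * I.encode.length := by
  have hX := encode_length I
  have hA : 1 ≤ (I.r + I.K + 2) ^ 2 := Nat.one_le_pow _ _ (by omega)
  have hX1 : I.encode.length ≤ (I.r + I.K + 2) ^ 2 * I.encode.length := Nat.le_mul_of_pos_left _ hA
  have hA1 : (I.r + I.K + 2) ^ 2 ≤ (I.r + I.K + 2) ^ 2 * I.encode.length :=
    Nat.le_mul_of_pos_right _ (by omega)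
  have hA2 : I.r + I.K + 2 ≤ (I.r + I.K + 2) ^ 2 := Nat.le_self_pow (by decide) _
  cases p <;> simp only [reduceCtorEq, true_or, or_true, false_or]
  · show I.r + 1 ≤ _
    omega
  · show I.edges.length + I.K + 1 ≤ _
    have : I.encode.length + (I.r + I.K + 2) ^ 2 ≤
        (I.r + I.K + 2) ^ 2 * I.encode.length + 1 := by
      obtain ⟨a, ha⟩ := Nat.exists_eq_add_of_le hA
      obtain ⟨b, hb⟩ := Nat.exists_eq_add_of_le (show 1 ≤ I.encode.length by omega)
      rw [ha, hb]
      nlinarith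
    omega
  · show I.K ≤ _
    omega
  · show I.r ≤ _
    omega
  · show I.edges.length ≤ _
    omega
  · show I.r * I.K + 1 ≤ _
    have : I.r * I.K + 1 ≤ (I.r + I.K + 2) ^ 2 := by nlinarith
    omega

/-- Compute the parameters, then search. -/
def algorithm : RamProg := .seq setup Cmd.search.compile

theorem algorithm_runs {w : ℕ} (hw : ∀ a ∈ I.encode, a < 2 ^ w)
    (hB : paramFactor (I.r, I.K) * I.encode.length ^ 4 < 2 ^ w) :
    Runs w algorithm (inputState I.encode) (paramFactor (I.r, I.K) * I.encode.length ^ 4)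
      fun τ => (I.yes → τ.reg 0 = 1) ∧ (¬ I.yes → τ.reg 0 = 0) := by
  have hE := inRange I
  have hle := par_le I
  have hlen := encode_length I
  set E := envOf I.encode with hEdef
  have hK : E.par .K = I.K := rfl
  have hΔ : E.par .Δ = I.Δ - 1 + 1 := rfl
  have hM : E.par .M = I.edges.length := rfl
  have hq : E.par .q = I.r * I.K + 1 := rfl
  have hN : E.par .N = (I.r + 1) ^ (I.K * (I.r * I.K + 1)) := rfl
  have hbase : E.par .base = 8 + 3 * E.par .P := rfl
  have hPval : E.par .P = I.edges.length + I.K + 1 := rfl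
  have hN1 : 1 ≤ E.par .N := by rw [hN]; exact Nat.one_le_pow _ _ (by omega)
  set Y := (I.r + I.K + 2) ^ 2 * I.encode.length with hY
  have hY1 : 1 ≤ Y := Nat.mul_pos (by positivity) (by omega)
  have hbound : paramFactor (I.r, I.K) * I.encode.length ^ 4 = 500 * (E.par .N * Y ^ 4) := by
    rw [paramFactor, hN, hY]
    ring
  rw [hbound] at hB ⊢
  have hYK : E.par .K ≤ Y := by simpa using hle .K
  have hYP : E.par .P ≤ Y := by simpa using hle .P
  have hYst : E.par .stride ≤ Y := by simpa using hle .stride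
  have hYq : E.par .q ≤ Y := by simpa using hle .q
  have p1 : 1 ≤ Y ^ 4 := Nat.one_le_pow _ _ hY1
  have p2 : Y ≤ Y ^ 4 := Nat.le_self_pow (by decide) Y
  have p3 : Y ^ 2 ≤ Y ^ 4 := Nat.pow_le_pow_right hY1 (by decide)
  have p4 : Y ^ 4 ≤ E.par .N * Y ^ 4 := Nat.le_mul_of_pos_left _ hN1
  have p5 : E.par .N ≤ E.par .N * Y ^ 4 := Nat.le_mul_of_pos_right _ p1
  have hKq : E.par .K * E.par .q ≤ Y ^ 2 := by rw [sq]; exact Nat.mul_le_mul hYK hYq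
  have hPst : E.par .P * E.par .stride ≤ Y ^ 2 := by rw [sq]; exact Nat.mul_le_mul hYP hYst
  have hinp : ∀ m, I.encode.getD m 0 < 2 ^ w := by
    intro m
    rcases lt_or_ge m I.encode.length with h | h
    · rw [List.getD_eq_getElem _ _ h]
      exact hw _ (List.getElem_mem h)
    · rw [List.getD_eq_default _ _ h]
      positivity
  have hfit : E.Fits w := by
    refine ⟨by omega, fun p => ?_, hinp, hE.posP, Nat.succ_pos _, hbase, by omega⟩
    rcases hle p with rfl | rfl | rfl | rfl | rfl | h
    · omega
    · omega
    · have := hinp 2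
      have : I.Δ < 2 ^ w := this
      omega
    · exact hinp 6
    · exact hinp 7
    · exact h.trans_lt (by omega)
  have hset : Runs w setup (inputState I.encode)
      (12 + (15 + (E.par .K * E.par .q * (2 + 1) + 1)))
      (Rep E ⟨fun _ => 0, fun _ _ _ => 0⟩) :=
    setup_runs hfit (show E.par .K * E.par .q < 2 ^ w by omega)
      (show I.encode.length ≤ E.par .base by omega)
  have hcost : Cmd.search.cost E.par =
      3 + (1 + (E.par .N * (Cmd.tryNumber.cost E.par + 2 + 1) + 1)) := rfl
  have htry := cost_tryNumber_le hY1 hle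
  have hsearch : E.par .N * (Cmd.tryNumber.cost E.par + 2 + 1) ≤ E.par .N * (396 * Y ^ 4) :=
    Nat.mul_le_mul_left _ (by omega)
  rw [Nat.mul_left_comm] at hsearch
  refine (Runs.seq (hset.mono le_rfl fun τ hR => Cmd.search.compile_runs hfit (by decide)
    ⟨fun _ => by positivity, fun _ _ _ => by positivity⟩ hR)).mono (by omega) ?_
  rintro τ ⟨hR, -⟩
  have hans := hR.var .ans
  simp only [Var.reg] at hans
  rw [hans]
  have key := Net.exists_accepts_iff (D := E.net) hE.posP hE.M (E.par .K) (E.par .Δ)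
  have hNval : (E.net.r + 1) ^ (E.par .K * E.net.rounds (E.par .K)) = E.par .N := rfl
  rw [hNval] at key
  have hyes : I.yes ↔ ∃ z < E.par .N, E.net.Accepts (E.par .K) (E.par .Δ) z :=
    (yes_iff I).trans key.symm
  rw [hyes]
  exact eval_search hE rfl _

end LoopRam

theorem mainTheorem6 : maxMinDiverseStringSet.FixedParameterTractable := by
  refine ⟨LoopRam.algorithm, LoopRam.paramFactor, 4, LoopRam.computable_paramFactor, by decide,
    fun I w hw hB => ?_⟩
  obtain ⟨T, τ, h1, h2, h3, h4⟩ := LoopRam.algorithm_runs I hw hB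
  exact ⟨T, τ, h1, h2, h3, h4⟩
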